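/- Fix $\kappa>0$, $P>0$, $\bar p\in\mathbb R$. For $\epsilon>0$ put $\Delta\alpha=\kappa\epsilon$, $\alpha_k=k\Delta\alpha$, $p_j=\bar p+j\epsilon$ and $\vec\alpha=(\cos\alpha,\sin\alpha)$ for $\alpha\in\mathbb R$. All sums over $(k,j)$ run over the pairs of integers with $|\alpha_k|\le\pi$ and $|p_j|\le P$. For every $\epsilon>0$ let $\eta_{k,j}=\eta^{\epsilon}_{k,j}$ be independent real random variables, indexed by these pairs, with finite third absolute moments, such that for some $\sigma\in C^1([-\pi,\pi]\times[-P,P])$ and a constant $c>0$ (independent of $\epsilon,k,j$) $$\mathbb E\eta_{k,j}=0,\qquad \mathbb E\eta_{k,j}^2=\sigma^2(\alpha_k,p_j)\Delta\alpha,\qquad \mathbb E|\eta_{k,j}|^3\le c(\Delta\alpha)^{3/2}.$$ Let $\varphi:\mathbb R\to\mathbb R$ be compactly supported with $\int\varphi=1$ and $\varphi^{(M+1)}\in L^\infty(\mathbb R)$ for an integer $M\ge3$ (that is, $\varphi\in C^{M}$ and $\varphi^{(M)}$ is an antiderivative of an $L^\infty$ function). Let $\mathcal H$ be the Hilbert transform,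 $\mathcal Hf(t)=\frac1\pi\,\mathrm{p.v.}\!\int \frac{f(s)}{t-s}\,ds$. Let $x_0\in\mathbb R^2$ be such that $\kappa|x_0|$ is irrational and of type $\nu>0$, i.e. for every $\nu_1>\nu$ there is $c'>0$ with $m^{\nu_1}\operatorname{dist}(m\kappa|x_0|,\mathbb Z)\ge c'$ for all integers $m\ge1$; and such that, for all $\alpha$ in some nonempty open set $\Omega\subset[-\pi,\pi]$, one has $|\vec\alpha\cdot x_0|\le P$ and $\sigma^2(\alpha,\vec\alpha\cdot x_0)\ne0$. Assume $M>\nu+1$. Let $$N^{\rm rec}_\epsilon(x)=-\frac{\Delta\alpha}{4\pi\epsilon}\sum_{k,j}\mathcal H\varphi'\Big(\frac{\vec\alpha_k\cdot x-p_j}{\epsilon}\Big)\eta_{k,j}.$$ Let $\check x_1,\dots,\check x_K\in\mathbb R^2$ be distinct, $0\ne\theta\in\mathbb R^K$, and $\xi_\epsilon=\sum_{i=1}^K\theta_iN^{\rm rec}_\epsilon(x_0+\epsilon\check x_i)$. With $a_k=(\vec\alpha_k\cdot x_0-\bar p)/\epsilon$ and $$w_{k,j}=\sum_{i=1}^K\theta_i\,\mathcal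 H\varphi'(a_k-j+\vec\alpha_k\cdot\check x_i)$$ one has $\xi_\epsilon=-\frac{\kappa}{4\pi}\sum_{k,j}w_{k,j}\eta_{k,j}$. Then, as $\epsilon\to0^+$, the variance of $\xi_\epsilon$ converges to a strictly positive limit, the denominator below is positive for all sufficiently small $\epsilon$, and $$\frac{\sum_{k,j}|w_{k,j}|^3\,\mathbb E|\eta_{k,j}|^3}{\Big[\sum_{k,j}w_{k,j}^2\,\mathbb E\eta_{k,j}^2\Big]^{3/2}}=O(\epsilon^{1/2}).$$ -/

import Mathlib

open Filter Topology MeasureTheory ProbabilityTheory Asymptotics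

namespace FBPNoise

/-- The plane `ℝ²` with its Euclidean structure. -/
abbrev Plane : Type := EuclideanSpace ℝ (Fin 2)

/-- The unit vector `(cos α, sin α)`. -/
noncomputable def dir (α : ℝ) : Plane := !₂[Real.cos α, Real.sin α]

/-- The dot product `(cos α, sin α) · x`. -/
noncomputable def proj (α : ℝ) (x : Plane) : ℝ := inner ℝ (dir α) x

/-- The Hilbert transform `(H f)(t) = (1/π) p.v. ∫ f(s) / (t - s) ds`, as a Cauchy principal value:
the limit, as `δ → 0⁺`, of the integrals over `|t - s| > δ`. -/
noncomputable def hilbert (f : ℝ → ℝ) (t : ℝ) : ℝ :=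
  limUnder (𝓝[>] (0 : ℝ)) fun δ : ℝ =>
    Real.pi⁻¹ * ∫ s in {s : ℝ | δ < |t - s|}, f s / (t - s)

/-! ### The sampling grid -/

/-- The angular step `Δα = κ Δp = κ ε`. -/
def dAlpha (κ ε : ℝ) : ℝ := κ * ε

/-- The angles `α_k = k Δα`. -/
def angle (κ ε : ℝ) (k : ℤ) : ℝ := k * dAlpha κ ε

/-- The signed distances `p_j = p̄ + j Δp`, with `Δp = ε`. -/
def offset (pbar ε : ℝ) (j : ℤ) : ℝ := pbar + j * ε

/-- The indices `(k, j)` of the grid points `(α_k, p_j)` in `[-π, π] × [-P, P]`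
(see `mem_grid`; meaningful for `κ, ε > 0`). -/
noncomputable def grid (κ pbar P ε : ℝ) : Finset (ℤ × ℤ) :=
  Finset.Icc ⌈-Real.pi / dAlpha κ ε⌉ ⌊Real.pi / dAlpha κ ε⌋ ×ˢ
    Finset.Icc ⌈(-P - pbar) / ε⌉ ⌊(P - pbar) / ε⌋

theorem mem_grid {κ pbar P ε : ℝ} (hκ : 0 < κ) (hε : 0 < ε) (q : ℤ × ℤ) :
    q ∈ grid κ pbar P ε ↔ |angle κ ε q.1| ≤ Real.pi ∧ |offset pbar ε q.2| ≤ P := by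
  have hα : 0 < dAlpha κ ε := mul_pos hκ hε
  rw [grid, Finset.mem_product, Finset.mem_Icc, Finset.mem_Icc, Int.ceil_le, Int.le_floor,
    Int.ceil_le, Int.le_floor, div_le_iff₀ hα, le_div_iff₀ hα, div_le_iff₀ hε, le_div_iff₀ hε,
    abs_le, abs_le, angle, offset]
  constructor
  · rintro ⟨⟨h1, h2⟩, h3, h4⟩
    exact ⟨⟨h1, h2⟩, by linarith, by linarith⟩
  · rintro ⟨⟨h1, h2⟩, h3, h4⟩
    exact ⟨⟨h1, h2⟩, by linarith, by linarith⟩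

/-! ### Assumptions -/

/-- Assumptions on the noise. For every step size `ε > 0` the noise is a family `η ε k j` of
independent random variables, indexed by the grid. -/
structure NoiseAssumption {S : Type*} [MeasurableSpace S] (μ : Measure S)
    (κ pbar P : ℝ) (σ : ℝ × ℝ → ℝ) (η : ℝ → ℤ → ℤ → S → ℝ) : Prop where
  measurable : ∀ ε > 0, ∀ q ∈ grid κ pbar P ε, Measurable (η ε q.1 q.2)
  indep : ∀ ε > 0, iIndepFun (fun (q : grid κ pbar P ε) => η ε q.1.1 q.1.2) μ
  /-- The first three moments exist. -/
  memLp : ∀ ε > 0, ∀ q ∈ grid κ pbar P ε, MemLp (η ε q.1 q.2) 3 μ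
  mean : ∀ ε > 0, ∀ q ∈ grid κ pbar P ε, ∫ ω, η ε q.1 q.2 ω ∂μ = 0
  contDiff_sigma : ContDiffOn ℝ 1 σ (Set.Icc (-Real.pi) Real.pi ×ˢ Set.Icc (-P) P)
  second_moment : ∀ ε > 0, ∀ q ∈ grid κ pbar P ε,
    ∫ ω, η ε q.1 q.2 ω ^ 2 ∂μ = σ (angle κ ε q.1, offset pbar ε q.2) ^ 2 * dAlpha κ ε
  /-- The constant is uniform in `ε`, `k` and `j`. -/
  third_moment : ∃ c > 0, ∀ ε > 0, ∀ q ∈ grid κ pbar P ε,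
    ∫ ω, |η ε q.1 q.2 ω| ^ 3 ∂μ ≤ c * dAlpha κ ε ^ (3 / 2 : ℝ)

/-- Assumptions on the kernel `φ`: compact support, `φ^{(M+1)} ∈ L^∞(ℝ)` for an integer `M ≥ 3`,
and integral one. The second condition says that `φ` is `C^M` and that `φ^{(M)}` is the
antiderivative of an essentially bounded function. -/
structure KernelAssumption (M : ℕ) (φ : ℝ → ℝ) : Prop where
  compact_support : HasCompactSupport φ
  three_le : 3 ≤ M
  contDiff : ContDiff ℝ M φ
  bounded_deriv : ∃ g : ℝ → ℝ, MemLp g ⊤ volume ∧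
    ∀ a b : ℝ, iteratedDeriv M φ b - iteratedDeriv M φ a = ∫ t in a..b, g t
  integral_eq_one : ∫ t, φ t = 1

/-- The distance `⟨r⟩` from `r` to the integers. -/
noncomputable def distInt (r : ℝ) : ℝ := Metric.infDist r (Set.range ((↑) : ℤ → ℝ))

/-- The irrational number `s` is of type `ν > 0`: for each `ν₁ > ν` there is `c > 0` with
`m ^ ν₁ ⟨m s⟩ ≥ c` for all `m = 1, 2, …`. -/
structure IsOfType (s ν : ℝ) : Prop where
  irrational : Irrational s
  pos : 0 < ν
  bound : ∀ ν₁ > ν, ∃ c > 0, ∀ m : ℕ, 1 ≤ m → c ≤ (m : ℝ) ^ ν₁ * distInt (m * s)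

/-- Assumptions on the point `x₀`: `κ |x₀|` is irrational of type `ν`, and `σ²(α, α⃗ · x₀)` is
(defined and) nonzero for all `α` in a nonempty open set of angles. -/
structure CenterAssumption (κ P : ℝ) (σ : ℝ × ℝ → ℝ) (ν : ℝ) (x₀ : Plane) : Prop where
  type : IsOfType (κ * ‖x₀‖) ν
  nondegenerate : ∃ O : Set ℝ, IsOpen O ∧ O.Nonempty ∧ O ⊆ Set.Icc (-Real.pi) Real.pi ∧
    ∀ α ∈ O, |proj α x₀| ≤ P ∧ σ (α, proj α x₀) ^ 2 ≠ 0

/-! ### Reconstruction from noise -/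

/-- The reconstruction from noise at the point `x`,
`N_ε(x) = -Δα/(4πε) ∑_{k,j} (H φ')((α⃗_k · x - p_j)/ε) η_{k,j}`. -/
noncomputable def noiseRec {S : Type*} (κ pbar P : ℝ) (φ : ℝ → ℝ) (η : ℝ → ℤ → ℤ → S → ℝ)
    (ε : ℝ) (x : Plane) (ω : S) : ℝ :=
  -(dAlpha κ ε / (4 * Real.pi * ε)) * ∑ q ∈ grid κ pbar P ε,
    hilbert (deriv φ) ((proj (angle κ ε q.1) x - offset pbar ε q.2) / ε) * η ε q.1 q.2 ω

/-- `ξ_ε = θ · (N_ε(x₀ + ε x̌_1), …, N_ε(x₀ + ε x̌_K))`. -/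
noncomputable def xi {S : Type*} (κ pbar P : ℝ) (φ : ℝ → ℝ) (η : ℝ → ℤ → ℤ → S → ℝ)
    (x₀ : Plane) {K : ℕ} (xc : Fin K → Plane) (θ : Fin K → ℝ) (ε : ℝ) (ω : S) : ℝ :=
  ∑ i, θ i * noiseRec κ pbar P φ η ε (x₀ + ε • xc i) ω

/-- `a_k = (α⃗_k · x₀ - p̄)/ε`. -/
noncomputable def aCoef (κ pbar : ℝ) (x₀ : Plane) (ε : ℝ) (k : ℤ) : ℝ :=
  (proj (angle κ ε k) x₀ - pbar) / ε

/-- The weight `∑_i θ_i (H φ')(a_k - j + α⃗_k · x̌_i)` of `η_{k,j}`, where `q = (k, j)`. -/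
noncomputable def weight (κ pbar : ℝ) (φ : ℝ → ℝ) (x₀ : Plane) {K : ℕ} (xc : Fin K → Plane)
    (θ : Fin K → ℝ) (ε : ℝ) (q : ℤ × ℤ) : ℝ :=
  ∑ i, θ i * hilbert (deriv φ) (aCoef κ pbar x₀ ε q.1 - q.2 + proj (angle κ ε q.1) (xc i))

/-- Up to the constant factor `-κ/(4π)`, `ξ_ε` is the sum of the independent variables
`weight · η_{k,j}`. -/
theorem xi_eq {S : Type*} (κ pbar P : ℝ) (φ : ℝ → ℝ) (η : ℝ → ℤ → ℤ → S → ℝ)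
    (x₀ : Plane) {K : ℕ} (xc : Fin K → Plane) (θ : Fin K → ℝ) {ε : ℝ} (hε : 0 < ε) (ω : S) :
    xi κ pbar P φ η x₀ xc θ ε ω = -(κ / (4 * Real.pi)) *
      ∑ q ∈ grid κ pbar P ε, weight κ pbar φ x₀ xc θ ε q * η ε q.1 q.2 ω := by
  have h1 : dAlpha κ ε / (4 * Real.pi * ε) = κ / (4 * Real.pi) := by
    have := Real.pi_ne_zero
    rw [dAlpha]; field_simp
  have h2 : ∀ (q : ℤ × ℤ) (i : Fin K),
      (proj (angle κ ε q.1) (x₀ + ε • xc i) - offset pbar ε q.2) / ε =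
        aCoef κ pbar x₀ ε q.1 - q.2 + proj (angle κ ε q.1) (xc i) := by
    intro q i
    simp only [proj, aCoef, offset, inner_add_right, inner_smul_right]
    field_simp
    ring
  simp only [xi, noiseRec, weight, h1, h2, Finset.mul_sum, Finset.sum_mul]
  rw [Finset.sum_comm]
  exact Finset.sum_congr rfl fun q _ => Finset.sum_congr rfl fun i _ => by ring

/-- `∑_{k,j} |weight|³ E|η_{k,j}|³`. -/
noncomputable def thirdMomentSum {S : Type*} [MeasurableSpace S] (μ : Measure S)
    (κ pbar P : ℝ) (φ : ℝ → ℝ) (η : ℝ → ℤ → ℤ → S → ℝ)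
    (x₀ : Plane) {K : ℕ} (xc : Fin K → Plane) (θ : Fin K → ℝ) (ε : ℝ) : ℝ :=
  ∑ q ∈ grid κ pbar P ε, |weight κ pbar φ x₀ xc θ ε q| ^ 3 * ∫ ω, |η ε q.1 q.2 ω| ^ 3 ∂μ

/-- `∑_{k,j} weight² E η_{k,j}²`. -/
noncomputable def varianceSum {S : Type*} [MeasurableSpace S] (μ : Measure S)
    (κ pbar P : ℝ) (φ : ℝ → ℝ) (η : ℝ → ℤ → ℤ → S → ℝ)
    (x₀ : Plane) {K : ℕ} (xc : Fin K → Plane) (θ : Fin K → ℝ) (ε : ℝ) : ℝ :=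
  ∑ q ∈ grid κ pbar P ε, weight κ pbar φ x₀ xc θ ε q ^ 2 * ∫ ω, η ε q.1 q.2 ω ^ 2 ∂μ

end FBPNoise

open FBPNoise

/-!
The point is that the variance of `ξ_ε` tends to an explicit positive limit; the bound of the
quotient follows from it, since the third moments trivially add up to `O(ε^(1/2))`
(`exists_thirdMomentSum_le`).

Up to a constant the variance is the sum over the grid of `Q(α_k, a_k - j) σ²(α_k, p_j) Δα`, where
`Q(α, r)` is the square of the weight `∑ i, θ_i (H φ')(r + α⃗ · x̌_i)`. The kernel `H φ'` is
continuous and `O(1 / t²)`, because `φ'` is Lipschitz with compact support and mean zero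
(`continuous_hilbert`, `exists_hilbert_bound`). Hence `Q` is concentrated where `p_j` is within a
few steps of `u(α_k) = α⃗_k · x₀`, so that `σ²` may be frozen there and the sum over `j` becomes
the periodization `Ψ(α_k, a_k) = ∑ j, Q(α_k, a_k - j)` (`tendsto_grid_sum`). The cutoff
`|p_j| ≤ P` is discontinuous, but is squeezed between Lipschitz ones, which differ only near the countably
many angles with `|u(α)| = P` (`tendsto_truncated_grid_sum`).

What remains is a sum over `k` of a function of the slow variable `α_k` and, with period one, of
the fast variable `a_k = (u(α_k) - p̄) / ε`. Replacing `k` by `k + h` with `h` bounded leaves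
`α_k` nearly unchanged and moves `a_k` by nearly `h κ u'(α_k)`. The sum is therefore unchanged in
the limit if each term is replaced by its Birkhoff average over `h < H` under the rotation by
`κ u'(α_k)`. As `x₀ ≠ 0`, this rotation is irrational for almost every angle, and then the Birkhoff
averages tend to the mean uniformly in the fast variable (`weyl_uniform`). Passing to the limit in
`ε` and then in `H` gives the integral over both variables (`tendsto_grid_average`).

The limit is positive unless, for almost every `α` in an open set, the function `Q(α, ·)` vanishes
identically. The shifts `α⃗ · x̌_i` are distinct for almost every `α`, so this would be a linear
relation between distinct translates of `H φ'`. Outside a bounded interval `H φ'` is a Cauchy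
transform without singularity, and its behaviour at infinity determines all moments of `φ'`; the
relation thus passes to the translates of `φ'`, where compact support excludes it
(`hilbert_translates_linearIndependent`).
-/

open FBPNoise

namespace FBPNoise

/-! ### The Hilbert transform of a compactly supported Lipschitz function -/

section Hilbert

variable {f : ℝ → ℝ} {L : NNReal} {R : ℝ}

/-- The integrand of the symmetrized principal value is bounded with bounded support, uniformly for
`|t| ≤ T`. -/
theorem abs_symmDiffQuot_le (hf : LipschitzWith L f) (hR : ∀ s, R < |s| → f s = 0) {t T : ℝ}
    (ht : |t| ≤ T) (y : ℝ) :
    |(f (t - y) - f (t + y)) / y| ≤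
      (Set.Icc (-(R + T)) (R + T)).indicator (fun _ => 2 * (L : ℝ)) y := by
  by_cases hy : y ∈ Set.Icc (-(R + T)) (R + T)
  · rw [Set.indicator_of_mem hy]
    rcases eq_or_ne y 0 with rfl | hy0
    · simp
    · rw [abs_div, div_le_iff₀ (abs_pos.2 hy0)]
      have := hf.dist_le_mul (t - y) (t + y)
      rw [Real.dist_eq, Real.dist_eq, show t - y - (t + y) = -(2 * y) by ring, abs_neg,
        abs_mul, abs_two] at this
      linarith
  · rw [Set.indicator_of_notMem hy]
    have hy' : R + T < |y| := by
      rw [Set.mem_Icc, ← abs_le] at hy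
      exact not_le.1 hy
    have h1 : f (t - y) = 0 := hR _ (by
      have := abs_sub_abs_le_abs_sub y t
      rw [abs_sub_comm] at this
      linarith)
    have h2 : f (t + y) = 0 := hR _ (by
      have := abs_sub_abs_le_abs_sub y (-t)
      rw [abs_neg, sub_neg_eq_add, add_comm y t] at this
      linarith)
    simp [h1, h2]

theorem integrable_indicator_Icc_const (a b c : ℝ) :
    Integrable ((Set.Icc a b).indicator fun _ : ℝ => c) :=
  (integrable_indicator_iff measurableSet_Icc).2 (integrableOn_const (by simp))

theorem aestronglyMeasurable_symmDiffQuot (hf : Continuous f) (t : ℝ) :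
    AEStronglyMeasurable (fun y => (f (t - y) - f (t + y)) / y) :=
  (((hf.comp (by fun_prop)).sub (hf.comp (by fun_prop))).measurable.div
    measurable_id).aestronglyMeasurable

theorem integrable_of_eq_zero_of_lt_abs (hf : Continuous f) (hR : ∀ s, R < |s| → f s = 0) :
    Integrable f :=
  hf.integrable_of_hasCompactSupport (HasCompactSupport.intro (isCompact_Icc (a := -R) (b := R))
    fun s hs => hR s (by rw [Set.mem_Icc, ← abs_le] at hs; exact not_le.1 hs))

/-- The truncated integral, symmetrized about the singularity. -/
theorem integral_truncated_eq (hf : Continuous f) (hR : ∀ s, R < |s| → f s = 0) (t : ℝ) {δ : ℝ}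
    (hδ : 0 < δ) :
    ∫ s in {s : ℝ | δ < |t - s|}, f s / (t - s) =
      2⁻¹ * ∫ y, {y : ℝ | δ < |y|}.indicator (fun y => (f (t - y) - f (t + y)) / y) y := by
  have hm : MeasurableSet {y : ℝ | δ < |y|} := measurableSet_lt (by fun_prop) (by fun_prop)
  have key : ∀ h : ℝ → ℝ, Integrable h → Continuous h →
      Integrable ({y : ℝ | δ < |y|}.indicator fun y => h y / y) := by
    intro h hi hc
    refine (hi.norm.div_const δ).mono'
      ((hc.measurable.div measurable_id).indicator hm).aestronglyMeasurable
      (ae_of_all _ fun y => ?_)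
    by_cases hy : y ∈ {y : ℝ | δ < |y|}
    · rw [Set.indicator_of_mem hy, norm_div]
      exact div_le_div_of_nonneg_left (norm_nonneg _) hδ (le_of_lt hy)
    · rw [Set.indicator_of_notMem hy, norm_zero]
      positivity
  have hint := integrable_of_eq_zero_of_lt_abs hf hR
  have i1 := key (fun y => f (t - y)) (hint.comp_sub_left t) (by fun_prop)
  have i2 := key (fun y => f (t + y)) (hint.comp_add_left t) (by fun_prop)
  have e1 : ∫ s in {s : ℝ | δ < |t - s|}, f s / (t - s) =
      ∫ y, {y : ℝ | δ < |y|}.indicator (fun y => f (t - y) / y) y := by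
    rw [← integral_indicator (measurableSet_lt (by fun_prop) (by fun_prop)),
      ← integral_sub_left_eq_self _ volume t]
    congr 1
    ext y
    simp [Set.indicator]
  -- The truncated region is symmetric and `1 / y` is odd.
  have e2 : ∫ y, {y : ℝ | δ < |y|}.indicator (fun y => f (t - y) / y) y =
      -∫ y, {y : ℝ | δ < |y|}.indicator (fun y => f (t + y) / y) y := by
    rw [← integral_neg_eq_self, ← integral_neg]
    congr 1
    ext y
    by_cases hy : δ < |y| <;> simp [Set.indicator, hy, div_neg]
  have e3 : ∫ y, {y : ℝ | δ < |y|}.indicator (fun y => (f (t - y) - f (t + y)) / y) y =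
      (∫ y, {y : ℝ | δ < |y|}.indicator (fun y => f (t - y) / y) y) -
        ∫ y, {y : ℝ | δ < |y|}.indicator (fun y => f (t + y) / y) y := by
    rw [← integral_sub i1 i2]
    congr 1
    ext y
    by_cases hy : δ < |y| <;> simp [Set.indicator, hy, sub_div]
  rw [e1, e3]
  linarith

/-- The principal value exists and is an absolutely convergent integral. -/
theorem hilbert_eq_integral (hf : LipschitzWith L f) (hR : ∀ s, R < |s| → f s = 0) (t : ℝ) :
    hilbert f t = Real.pi⁻¹ * (2⁻¹ * ∫ y, (f (t - y) - f (t + y)) / y) := by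
  refine Tendsto.limUnder_eq (Tendsto.const_mul _ ?_)
  have hlim : Tendsto (fun δ : ℝ => ∫ y, {y : ℝ | δ < |y|}.indicator
      (fun y => (f (t - y) - f (t + y)) / y) y) (𝓝[>] 0)
      (𝓝 (∫ y, (f (t - y) - f (t + y)) / y)) := by
    refine tendsto_integral_filter_of_dominated_convergence
      ((Set.Icc (-(R + |t|)) (R + |t|)).indicator (fun _ => 2 * (L : ℝ)))
      (Eventually.of_forall fun δ => ?_) (Eventually.of_forall fun δ => ae_of_all _ fun y => ?_)
      (integrable_indicator_Icc_const _ _ _) (ae_of_all _ fun y => ?_)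
    · exact (aestronglyMeasurable_symmDiffQuot hf.continuous t).indicator
        (measurableSet_lt (by fun_prop) (by fun_prop))
    · exact (norm_indicator_le_norm_self _ _).trans (abs_symmDiffQuot_le hf hR le_rfl y)
    · rcases eq_or_ne y 0 with rfl | hy
      · simp [Set.indicator]
      · refine tendsto_const_nhds.congr' ?_
        filter_upwards [Ioo_mem_nhdsGT (abs_pos.2 hy)] with δ hδ
        rw [Set.indicator_of_mem]
        exact hδ.2
  refine (hlim.const_mul 2⁻¹).congr' ?_
  filter_upwards [self_mem_nhdsWithin] with δ hδ
  exact (integral_truncated_eq hf.continuous hR t hδ).symm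

theorem continuous_hilbert (hf : LipschitzWith L f) (hR : ∀ s, R < |s| → f s = 0) :
    Continuous (hilbert f) := by
  rw [show hilbert f = _ from funext (hilbert_eq_integral hf hR)]
  refine continuous_const.mul (continuous_const.mul (continuous_iff_continuousAt.2 fun t => ?_))
  refine continuousAt_of_dominated
    (bound := (Set.Icc (-(R + (|t| + 1))) (R + (|t| + 1))).indicator (fun _ => 2 * (L : ℝ)))
    (Eventually.of_forall fun s => aestronglyMeasurable_symmDiffQuot hf.continuous s) ?_
    (integrable_indicator_Icc_const _ _ _) (ae_of_all _ fun y => ?_)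
  · have : ∀ᶠ s in 𝓝 t, |s| < |t| + 1 :=
      continuous_abs.continuousAt.eventually_lt continuousAt_const (by simp)
    filter_upwards [this] with s hs
    exact ae_of_all _ fun y => abs_symmDiffQuot_le hf hR hs.le y
  · have := hf.continuous
    exact Continuous.continuousAt (by fun_prop)

/-- Off the support the integral is not singular. -/
theorem hilbert_eq_of_lt_abs (hR : ∀ s, R < |s| → f s = 0) {t : ℝ} (ht : R < |t|) :
    hilbert f t = Real.pi⁻¹ * ∫ s, f s / (t - s) := by
  refine Tendsto.limUnder_eq (tendsto_const_nhds.congr' ?_)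
  filter_upwards [Ioo_mem_nhdsGT (sub_pos.2 ht)] with δ hδ
  congr 1
  refine (setIntegral_eq_integral_of_forall_compl_eq_zero fun s hs => ?_).symm
  rw [hR s, zero_div]
  have h1 := abs_sub_abs_le_abs_sub t s
  have h2 : |t - s| ≤ δ := not_lt.1 hs
  linarith [hδ.2]

/-- The Hilbert transform of a function of mean zero decays quadratically. -/
theorem exists_hilbert_bound (hf : LipschitzWith L f) (hR : ∀ s, R < |s| → f s = 0)
    (h0 : ∫ s, f s = 0) : ∃ C, 0 < C ∧ ∀ t, |hilbert f t| ≤ C / (1 + t ^ 2) := by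
  have hint := integrable_of_eq_zero_of_lt_abs hf.continuous hR
  set T := 2 * |R| + 1 with hT
  obtain ⟨B, hB⟩ := (isCompact_Icc (a := -T) (b := T)).exists_bound_of_continuousOn
    (continuous_hilbert hf hR).continuousOn
  set I := ∫ s, |f s| with hI
  have hI0 : 0 ≤ I := integral_nonneg fun s => abs_nonneg _
  have hRT : R ≤ |R| := le_abs_self R
  have hR0 := abs_nonneg R
  refine ⟨|B| * (1 + T ^ 2) + Real.pi⁻¹ * (4 * |R| * I) + 1, by positivity, fun t => ?_⟩
  rw [le_div_iff₀ (by positivity)]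
  have hpi := Real.pi_pos
  rcases le_or_gt |t| T with ht | ht
  · have h1 : |hilbert f t| ≤ |B| := (hB t (abs_le.1 ht)).trans (le_abs_self B)
    have h2 : t ^ 2 ≤ T ^ 2 := sq_le_sq' (by linarith [(abs_le.1 ht).1]) (abs_le.1 ht).2
    have : |hilbert f t| * (1 + t ^ 2) ≤ |B| * (1 + T ^ 2) := by gcongr
    have : 0 ≤ Real.pi⁻¹ * (4 * |R| * I) := by positivity
    linarith
  · have ht1 : 1 < |t| := by linarith
    have ht0 : t ≠ 0 := abs_pos.1 (by linarith)
    rw [hilbert_eq_of_lt_abs hR (by linarith)]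
    have hpt : ∀ s, |f s / (t - s) - f s / t| ≤ |f s| * (2 * |R| / t ^ 2) := by
      intro s
      rcases lt_or_ge R |s| with hs | hs
      · simp [hR s hs]
      · have h1 : |t| / 2 ≤ |t - s| := by
          have := abs_sub_abs_le_abs_sub t s
          linarith
        have hts : t - s ≠ 0 := abs_pos.1 (by linarith)
        have e : f s / (t - s) - f s / t = f s * (s / ((t - s) * t)) := by
          field_simp
          ring
        rw [e, abs_mul, abs_div, abs_mul]
        refine mul_le_mul_of_nonneg_left ?_ (abs_nonneg _)
        have h2 : |t| ^ 2 / 2 ≤ |t - s| * |t| := by nlinarith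
        rw [← sq_abs t]
        calc |s| / (|t - s| * |t|) ≤ |R| / (|t| ^ 2 / 2) :=
              div_le_div₀ hR0 (hs.trans hRT) (by positivity) h2
          _ = _ := by field_simp
    -- Since `f` has mean zero, `1 / (t - s)` may be replaced by `1 / (t - s) - 1 / t`.
    have e0 : ∫ s, f s / (t - s) = ∫ s, (f s / (t - s) - f s / t) := by
      have hi2 : Integrable fun s => f s / t := hint.div_const t
      have hi3 : Integrable fun s => f s / (t - s) - f s / t :=
        (hint.abs.mul_const _).mono' (((hf.continuous.measurable.div (by fun_prop)).sub
          (hf.continuous.measurable.div_const _)).aestronglyMeasurable) (ae_of_all _ hpt)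
      have hi1 : Integrable fun s => f s / (t - s) := 
        (hi3.add hi2).congr (ae_of_all _ fun s => by simp)
      rw [integral_sub hi1 hi2, integral_div, h0]
      simp
    have hb : |∫ s, f s / (t - s)| ≤ I * (2 * |R| / t ^ 2) := by
      rw [e0, hI, ← integral_mul_const]
      exact norm_integral_le_of_norm_le (f := fun s => f s / (t - s) - f s / t)
        (hint.abs.mul_const _) (ae_of_all _ hpt)
    have h1t : 1 + t ^ 2 ≤ 2 * t ^ 2 := by
      rw [← sq_abs t]
      nlinarith
    rw [abs_mul, abs_of_pos (inv_pos.2 hpi)]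
    have : Real.pi⁻¹ * |∫ s, f s / (t - s)| * (1 + t ^ 2) ≤
        Real.pi⁻¹ * (I * (2 * |R| / t ^ 2)) * (2 * t ^ 2) := by gcongr
    have e4 : Real.pi⁻¹ * (I * (2 * |R| / t ^ 2)) * (2 * t ^ 2) = Real.pi⁻¹ * (4 * |R| * I) := by
      field_simp
      ring
    have : 0 ≤ |B| * (1 + T ^ 2) := by positivity
    linarith

end Hilbert

/-! ### Linear independence of the translates of a Hilbert transform -/

section Independence

variable {f : ℝ → ℝ} {R : ℝ}

theorem integrable_mul_of_eq_zero_of_lt_abs (hf : Continuous f) (hR : ∀ s, R < |s| → f s = 0)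
    {h : ℝ → ℝ} (hh : Continuous h) : Integrable fun s => h s * f s :=
  integrable_of_eq_zero_of_lt_abs (R := R) (hh.mul hf) fun s hs => by simp [hR s hs]

theorem integrable_mul_div_sub (hf : Continuous f) (hR : ∀ s, R < |s| → f s = 0)
    {h : ℝ → ℝ} (hh : Continuous h) {t : ℝ} (ht : |R| + 1 < t) :
    Integrable fun s => h s * f s / (t - s) := by
  refine (integrable_mul_of_eq_zero_of_lt_abs hf hR hh).abs.mono'
    (((hh.mul hf).measurable.div (by fun_prop)).aestronglyMeasurable) (ae_of_all _ fun s => ?_)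
  rcases lt_or_ge R |s| with hs | hs
  · simp [hR s hs]
  · have h1 : 1 ≤ |t - s| := by
      have := le_abs_self (t - s)
      have := le_abs_self s
      have := le_abs_self R
      linarith
    rw [norm_div]
    exact div_le_self (norm_nonneg _) h1

/-- A compactly supported function is determined by its moments. -/
theorem eq_zero_of_moments_eq_zero (hf : Continuous f) (hR : ∀ s, R < |s| → f s = 0)
    (hm : ∀ n : ℕ, ∫ s, s ^ n * f s = 0) : f = 0 := by
  have hpoly : ∀ p : Polynomial ℝ, ∫ s, p.eval s * f s = 0 := by
    intro p
    have : ∀ s, p.eval s * f s = ∑ n ∈ Finset.range (p.natDegree + 1),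
        p.coeff n * (s ^ n * f s) := by
      intro s
      rw [Polynomial.eval_eq_sum_range, Finset.sum_mul]
      exact Finset.sum_congr rfl fun n _ => by ring
    simp_rw [this]
    rw [integral_finsetSum _ fun n _ =>
      (integrable_mul_of_eq_zero_of_lt_abs hf hR (by fun_prop)).const_mul _]
    simp [integral_const_mul, hm]
  have hint := integrable_of_eq_zero_of_lt_abs hf hR
  have hsq : ∫ s, f s * f s = 0 := by
    have h0 : 0 ≤ ∫ s, f s * f s := integral_nonneg fun s => mul_self_nonneg _
    refine le_antisymm (le_of_forall_pos_le_add fun e he => ?_) h0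
    set I := ∫ s, |f s|
    have hI0 : 0 ≤ I := integral_nonneg fun s => abs_nonneg _
    obtain ⟨p, hp⟩ := exists_polynomial_near_of_continuousOn (-R) R f hf.continuousOn
      (e / (I + 1)) (by positivity)
    have h1 : ∫ s, f s * f s = ∫ s, (f s - p.eval s) * f s := by
      simp_rw [sub_mul]
      rw [integral_sub (integrable_mul_of_eq_zero_of_lt_abs hf hR hf)
        (integrable_mul_of_eq_zero_of_lt_abs hf hR p.continuous), hpoly, sub_zero]
    have h2 : ‖∫ s, (f s - p.eval s) * f s‖ ≤ ∫ s, e / (I + 1) * |f s| := by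
      refine norm_integral_le_of_norm_le (hint.abs.const_mul _) (ae_of_all _ fun s => ?_)
      rcases lt_or_ge R |s| with hs | hs
      · simp [hR s hs]
      · rw [norm_mul, Real.norm_eq_abs, Real.norm_eq_abs, abs_sub_comm]
        exact mul_le_mul_of_nonneg_right (hp s (abs_le.1 hs)).le (abs_nonneg _)
    rw [h1, zero_add]
    refine (le_abs_self _).trans (h2.trans ?_)
    rw [integral_const_mul, div_mul_eq_mul_div, div_le_iff₀ (by positivity)]
    nlinarith
  have h3 := (integral_eq_zero_iff_of_nonneg (fun s => mul_self_nonneg (f s))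
    (integrable_mul_of_eq_zero_of_lt_abs hf hR hf)).1 hsq
  have h4 := (Continuous.ae_eq_iff_eq volume (hf.mul hf) continuous_const).1 h3
  funext s
  exact mul_self_eq_zero.1 (congrFun h4 s)

/-- The Cauchy transform of a compactly supported function determines the function already near
infinity: dividing `s ^ (n + 1)` by `t - s` shows inductively that the Cauchy transforms of all
`s ^ n * f s` vanish near infinity too, and then so do the moments. -/
theorem eq_zero_of_cauchy_eq_zero (hf : Continuous f) (hR : ∀ s, R < |s| → f s = 0)
    (h : ∀ t, |R| + 1 < t → ∫ s, f s / (t - s) = 0) : f = 0 := by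
  -- A Cauchy transform vanishes at infinity.
  have hdecay : ∀ n : ℕ, Tendsto (fun t => ∫ s, s ^ n * f s / (t - s)) atTop (𝓝 0) := by
    intro n
    rw [show (0 : ℝ) = ∫ _ : ℝ, (0 : ℝ) by simp]
    refine tendsto_integral_filter_of_dominated_convergence (fun s => |s ^ n * f s|)
      (Eventually.of_forall fun t => ?_) ?_
      (integrable_mul_of_eq_zero_of_lt_abs hf hR (by fun_prop)).abs (ae_of_all _ fun s => ?_)
    · exact ((((continuous_id.pow n).mul hf).measurable.div (by fun_prop)).aestronglyMeasurable)
    · filter_upwards [eventually_gt_atTop (|R| + 1)] with t ht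
      refine ae_of_all _ fun s => ?_
      rcases lt_or_ge R |s| with hs | hs
      · simp [hR s hs]
      · have h1 : 1 ≤ |t - s| := by
          have := le_abs_self (t - s)
          have := le_abs_self s
          have := le_abs_self R
          linarith
        rw [norm_div]
        exact div_le_self (norm_nonneg _) h1
    · exact Tendsto.div_atTop tendsto_const_nhds
        (tendsto_atTop_add_const_right _ (-s) tendsto_id)
  have hstep : ∀ n : ℕ, ∀ t, |R| + 1 < t → ∫ s, s ^ (n + 1) * f s / (t - s) =
      t * (∫ s, s ^ n * f s / (t - s)) - ∫ s, s ^ n * f s := by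
    intro n t ht
    rw [← integral_const_mul, ← integral_sub
      ((integrable_mul_div_sub hf hR (by fun_prop) ht).const_mul t)
      (integrable_mul_of_eq_zero_of_lt_abs hf hR (by fun_prop))]
    congr 1
    ext s
    rcases lt_or_ge R |s| with hs | hs
    · simp [hR s hs]
    · have : t - s ≠ 0 := by
        have := le_abs_self s
        have := le_abs_self R
        intro hts
        linarith
      field_simp
      ring
  have hmom : ∀ n : ℕ, (∀ t, |R| + 1 < t → ∫ s, s ^ n * f s / (t - s) = 0) →
      ∫ s, s ^ n * f s = 0 := by
    intro n hn
    have h1 : Tendsto (fun t => ∫ s, s ^ (n + 1) * f s / (t - s)) atTop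
        (𝓝 (-∫ s, s ^ n * f s)) := by
      refine tendsto_const_nhds.congr' ?_
      filter_upwards [eventually_gt_atTop (|R| + 1)] with t ht
      rw [hstep n t ht, hn t ht]
      ring
    have := tendsto_nhds_unique h1 (hdecay (n + 1))
    linarith
  have hall : ∀ n : ℕ, ∀ t, |R| + 1 < t → ∫ s, s ^ n * f s / (t - s) = 0 := by
    intro n
    induction n with
    | zero => simpa using h
    | succ n ih =>
      intro t ht
      rw [hstep n t ht, ih t ht, hmom n ih]
      ring
  exact eq_zero_of_moments_eq_zero hf hR fun n => hmom n (hall n)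

/-- Distinct translates of a nonzero compactly supported function are linearly independent: the
translate that reaches farthest to the right is alone there. -/
theorem translates_linearIndependent (hR : ∀ s, R < |s| → f s = 0)
    (hf0 : f ≠ 0) {K : ℕ} {b θ : Fin K → ℝ} (hb : Function.Injective b)
    (h : ∀ s, ∑ i, θ i * f (s + b i) = 0) : θ = 0 := by
  by_contra hθ
  obtain ⟨i₁, hi₁⟩ := Function.ne_iff.1 hθ
  obtain ⟨i₀, hi₀, hmin⟩ := Finset.exists_min_image (Finset.univ.filter fun i => θ i ≠ 0) b
    ⟨i₁, by simpa using hi₁⟩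
  have hi₀' : θ i₀ ≠ 0 := by simpa using hi₀
  set T := sSup {s | f s ≠ 0} with hT
  have hne : {s | f s ≠ 0}.Nonempty := Function.ne_iff.1 hf0
  have hbdd : BddAbove {s | f s ≠ 0} := ⟨R, fun s hs => by
    by_contra hc
    exact hs (hR s ((not_le.1 hc).trans_le (le_abs_self s)))⟩
  have hgap : ∃ d > 0, ∀ i, θ i ≠ 0 → i ≠ i₀ → b i₀ + d ≤ b i := by
    classical
    rcases (Finset.univ.filter fun i => θ i ≠ 0 ∧ i ≠ i₀).eq_empty_or_nonempty with he | he
    · refine ⟨1, one_pos, fun i h1 h2 => ?_⟩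
      have : i ∈ (Finset.univ.filter fun i => θ i ≠ 0 ∧ i ≠ i₀) := by simp [h1, h2]
      simp [he] at this
    · obtain ⟨i₂, hi₂, hmin₂⟩ := Finset.exists_min_image _ b he
      simp only [Finset.mem_filter, Finset.mem_univ, true_and] at hi₂ hmin₂ hmin
      refine ⟨b i₂ - b i₀, sub_pos.2 (lt_of_le_of_ne (hmin _ hi₂.1)
        fun hc => hi₂.2 (hb hc).symm), fun i h1 h2 => ?_⟩
      linarith [hmin₂ i ⟨h1, h2⟩]
  obtain ⟨d, hd, hgap⟩ := hgap
  obtain ⟨s, hs, hsT⟩ := exists_lt_of_lt_csSup hne (show T - d < T by linarith)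
  have h1 := h (s - b i₀)
  rw [Finset.sum_eq_single i₀] at h1
  · rw [sub_add_cancel] at h1
    exact (mul_ne_zero hi₀' hs) h1
  · intro i _ hi
    by_cases hθi : θ i = 0
    · simp [hθi]
    · have : f (s - b i₀ + b i) = 0 := by
        by_contra hc
        have h2 := le_csSup hbdd hc
        have h3 := hgap i hθi hi
        linarith
      rw [this, mul_zero]
  · simp

/-- Near infinity a combination of translates of `hilbert f` is the Cauchy transform of the same
combination of translates of `f`. -/
theorem hilbert_translates_linearIndependent (hf : Continuous f) (hR : ∀ s, R < |s| → f s = 0)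
    (hf0 : f ≠ 0) {K : ℕ} {b θ : Fin K → ℝ} (hb : Function.Injective b)
    (h : ∀ t, ∑ i, θ i * hilbert f (t + b i) = 0) : θ = 0 := by
  refine translates_linearIndependent hR hf0 hb fun s => ?_
  set B := ∑ i, |b i| with hB
  have hbB : ∀ i, |b i| ≤ B := fun i =>
    Finset.single_le_sum (f := fun i => |b i|) (fun i _ => abs_nonneg _) (Finset.mem_univ i)
  have hB0 : 0 ≤ B := Finset.sum_nonneg fun i _ => abs_nonneg _
  have hR' : ∀ i s, |R| + B < |s| → f (s + b i) = 0 := by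
    intro i s hs
    refine hR _ ?_
    have h1 := abs_sub_abs_le_abs_sub s (-b i)
    rw [abs_neg, sub_neg_eq_add] at h1
    linarith [hbB i, le_abs_self R]
  refine congrFun (eq_zero_of_cauchy_eq_zero (f := fun s => ∑ i, θ i * f (s + b i))
    (R := |R| + B) (by fun_prop) (fun s hs => ?_) fun t ht => ?_) s
  · exact Finset.sum_eq_zero fun i _ => by rw [hR' i s hs, mul_zero]
  · have hint : ∀ i, Integrable fun s => f (s + b i) / (t - s) := fun i => by
      simpa using integrable_mul_div_sub (f := fun s => f (s + b i)) (by fun_prop) (hR' i)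
        (continuous_const (y := (1 : ℝ))) ht
    rw [abs_of_nonneg (by positivity)] at ht
    simp_rw [Finset.sum_div, mul_div_assoc]
    rw [integral_finsetSum _ fun i _ => (hint i).const_mul _]
    simp_rw [integral_const_mul]
    have h1 : ∀ i, ∫ s, f (s + b i) / (t - s) = Real.pi * hilbert f (t + b i) := by
      intro i
      have ht' : R < |t + b i| := by
        have := neg_abs_le (b i)
        have := le_abs_self (t + b i)
        linarith [hbB i, le_abs_self R]
      rw [hilbert_eq_of_lt_abs hR ht', mul_inv_cancel_left₀ Real.pi_ne_zero,
        ← integral_add_right_eq_self (fun s => f s / (t + b i - s)) (b i)]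
      congr 1
      ext s
      congr 1
      ring
    simp_rw [h1, mul_left_comm _ Real.pi, ← Finset.mul_sum, h t, mul_zero]

end Independence

/-! ### Uniform equidistribution of an irrational rotation -/

section Weyl

theorem norm_sum_fourier_le (β : UnitAddCircle) (n : ℤ) (hn : fourier n β ≠ 1) (N : ℕ)
    (x : UnitAddCircle) :
    ‖∑ h ∈ Finset.range N, fourier n (x + h • β)‖ ≤ 2 / ‖fourier n β - 1‖ := by
  have h1 : ∀ h : ℕ, fourier n (x + h • β) = fourier n x * fourier n β ^ h := by
    intro h
    simp only [fourier_apply, smul_add, AddCircle.toCircle_add, Circle.coe_mul]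
    rw [smul_comm, AddCircle.toCircle_nsmul, Circle.coe_pow]
  have h2 : ‖fourier n β‖ = 1 := Circle.norm_coe _
  have h3 : ‖fourier n x‖ = 1 := Circle.norm_coe _
  simp_rw [h1]
  rw [← Finset.mul_sum, norm_mul, h3, one_mul, geom_sum_eq hn, norm_div]
  refine div_le_div_of_nonneg_right ?_ (norm_nonneg _)
  refine (norm_sub_le _ _).trans ?_
  rw [norm_pow, h2, one_pow, norm_one]
  norm_num

theorem fourier_ne_one {β : ℝ} (hβ : Irrational β) {n : ℤ} (hn : n ≠ 0) :
    fourier n (β : UnitAddCircle) ≠ 1 := by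
  rw [fourier_coe_apply]
  intro h
  obtain ⟨m, hm⟩ := Complex.exp_eq_one_iff.1 h
  have h1 : (n : ℂ) * β = m := by
    have h2 : (2 * Real.pi * Complex.I : ℂ) ≠ 0 := Complex.two_pi_I_ne_zero
    apply mul_left_cancel₀ h2
    rw [← mul_assoc, mul_comm _ (m : ℂ), ← hm]
    simp
  have h2 : (n : ℝ) * β = m := by exact_mod_cast h1
  exact (hβ.intCast_mul hn).ne_int m h2

/-- Weyl's criterion: the average of a nontrivial character is a geometric sum, and the characters
span a dense subspace of the continuous functions. -/
theorem weyl_complex {β : ℝ} (hβ : Irrational β) (F : C(UnitAddCircle, ℂ)) {e : ℝ} (he : 0 < e) :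
    ∀ᶠ N : ℕ in atTop, ∀ x : UnitAddCircle,
      ‖(N : ℂ)⁻¹ * ∑ h ∈ Finset.range N, F (x + h • (β : UnitAddCircle)) - ∫ y, F y‖ ≤ e := by
  have hint : ∀ F : C(UnitAddCircle, ℂ), Integrable F := fun F =>
    F.continuous.integrable_of_hasCompactSupport (HasCompactSupport.of_compactSpace _)
  have hspan : ∀ F ∈ Submodule.span ℂ (Set.range (fourier (T := 1))), ∀ e > 0,
      ∀ᶠ N : ℕ in atTop, ∀ x : UnitAddCircle,
      ‖(N : ℂ)⁻¹ * ∑ h ∈ Finset.range N, F (x + h • (β : UnitAddCircle)) - ∫ y, F y‖ ≤ e := by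
    intro F hF
    induction hF using Submodule.span_induction with
    | mem F hF =>
      obtain ⟨n, rfl⟩ := hF
      intro e he
      by_cases hn : n = 0
      · subst hn
        filter_upwards [eventually_ge_atTop 1] with N hN x
        have hN' : (N : ℂ) ≠ 0 := by exact_mod_cast (by omega : N ≠ 0)
        have hv : (volume : Measure UnitAddCircle).real Set.univ = 1 := by
          rw [measureReal_def, UnitAddCircle.measure_univ, ENNReal.toReal_one]
        simp [hN', hv, he.le]
      · have hne := fourier_ne_one hβ hn
        have hz : ∫ y : UnitAddCircle, fourier n y = 0 := by
          -- The integral is invariant under the rotation, which multiplies it by a number `≠ 1`.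
          have h1 : ∫ y : UnitAddCircle, fourier n (y + (β : UnitAddCircle)) =
              ∫ y : UnitAddCircle, fourier n y := integral_add_right_eq_self _ _
          have h2 : ∀ y : UnitAddCircle, fourier n (y + (β : UnitAddCircle)) =
              fourier n y * fourier n (β : UnitAddCircle) := fun y => by
            simp only [fourier_apply, smul_add, AddCircle.toCircle_add, Circle.coe_mul]
          simp_rw [h2] at h1
          rw [integral_mul_const] at h1
          by_contra hc
          exact hne (mul_left_cancel₀ hc (h1.trans (mul_one _).symm))
        have hlim : Tendsto (fun N : ℕ => 2 / ‖fourier n (β : UnitAddCircle) - 1‖ / (N : ℝ))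
          atTop (𝓝 0) := tendsto_const_div_atTop_nhds_zero_nat _
        filter_upwards [hlim.eventually_le_const he] with N hN x
        rw [hz, sub_zero, norm_mul, norm_inv, Complex.norm_natCast, inv_mul_eq_div]
        refine le_trans ?_ hN
        exact div_le_div_of_nonneg_right (norm_sum_fourier_le _ n hne N x) (Nat.cast_nonneg _)
    | zero =>
      intro e he
      refine Eventually.of_forall fun N x => ?_
      simp [he.le]
    | add F₁ F₂ _ _ h₁ h₂ =>
      intro e he
      filter_upwards [h₁ (e / 2) (half_pos he), h₂ (e / 2) (half_pos he)] with N h1 h2 x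
      simp only [ContinuousMap.add_apply]
      rw [Finset.sum_add_distrib, mul_add, integral_add (hint F₁) (hint F₂), add_sub_add_comm]
      exact (norm_add_le _ _).trans (by linarith [h1 x, h2 x])
    | smul c F _ h =>
      intro e he
      filter_upwards [h (e / (‖c‖ + 1)) (by positivity)] with N h1 x
      simp only [ContinuousMap.smul_apply, smul_eq_mul]
      rw [← Finset.mul_sum, mul_left_comm, integral_const_mul, ← mul_sub, norm_mul]
      have h2 := h1 x
      rw [le_div_iff₀ (by positivity)] at h2
      nlinarith [norm_nonneg ((N : ℂ)⁻¹ * ∑ h ∈ Finset.range N, F (x + h • (β : UnitAddCircle)) -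
        ∫ y, F y)]
  have hd : F ∈ (Submodule.span ℂ (Set.range (fourier (T := 1)))).topologicalClosure := by
    rw [span_fourier_closure_eq_top]
    trivial
  obtain ⟨p, hp, hpF⟩ := Metric.mem_closure_iff.1 hd (e / 3) (by positivity)
  have hpt : ∀ x, ‖F x - p x‖ ≤ e / 3 := fun x => by
    rw [← dist_eq_norm]
    exact (ContinuousMap.dist_apply_le_dist x).trans hpF.le
  filter_upwards [hspan p hp (e / 3) (by positivity), eventually_ge_atTop 1] with N hN hN1 x
  have hN0 : (0 : ℝ) < N := by exact_mod_cast hN1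
  have h1 : ‖(N : ℂ)⁻¹ * ∑ h ∈ Finset.range N, F (x + h • (β : UnitAddCircle)) -
      (N : ℂ)⁻¹ * ∑ h ∈ Finset.range N, p (x + h • (β : UnitAddCircle))‖ ≤ e / 3 := by
    rw [← mul_sub, ← Finset.sum_sub_distrib, norm_mul, norm_inv, Complex.norm_natCast,
      inv_mul_le_iff₀ hN0]
    refine (norm_sum_le_of_le _ fun h _ => hpt _).trans ?_
    simp
  have h2 : ‖(∫ y, p y) - ∫ y, F y‖ ≤ e / 3 := by
    rw [← integral_sub (hint p) (hint F)]
    refine (norm_integral_le_of_norm_le_const (C := e / 3) (ae_of_all _ fun y => ?_)).trans ?_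
    · rw [norm_sub_rev]
      exact hpt y
    · rw [measureReal_def, UnitAddCircle.measure_univ, ENNReal.toReal_one, mul_one]
  have h3 := norm_add₃_le (a := (N : ℂ)⁻¹ * ∑ h ∈ Finset.range N, F (x + h • (β : UnitAddCircle)) -
      (N : ℂ)⁻¹ * ∑ h ∈ Finset.range N, p (x + h • (β : UnitAddCircle)))
    (b := (N : ℂ)⁻¹ * ∑ h ∈ Finset.range N, p (x + h • (β : UnitAddCircle)) - ∫ y, p y)
    (c := (∫ y, p y) - ∫ y, F y)
  rw [sub_add_sub_cancel, sub_add_sub_cancel] at h3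
  linarith [hN x]

/-- Birkhoff averages of a continuous function along an irrational rotation of the circle converge
uniformly to the mean. -/
theorem weyl_uniform {β : ℝ} (hβ : Irrational β) {F : ℝ → ℝ} (hF : Continuous F)
    (hper : Function.Periodic F 1) {e : ℝ} (he : 0 < e) :
    ∀ᶠ N : ℕ in atTop, ∀ a : ℝ,
      |(N : ℝ)⁻¹ * ∑ h ∈ Finset.range N, F (a + h * β) - ∫ y in (0 : ℝ)..1, F y| ≤ e := by
  have hc : Continuous (fun x : UnitAddCircle => ((hper.lift x : ℝ) : ℂ)) :=
    Complex.continuous_ofReal.comp (continuous_coinduced_dom.2 hF)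
  filter_upwards [weyl_complex hβ ⟨_, hc⟩ he] with N hN a
  have h1 := hN (a : UnitAddCircle)
  simp only [ContinuousMap.coe_mk] at h1
  rw [← UnitAddCircle.intervalIntegral_preimage 0] at h1
  have h2 : ∀ h : ℕ, (a : UnitAddCircle) + h • (β : UnitAddCircle) =
      ((a + h * β : ℝ) : UnitAddCircle) := fun h => by
    rw [← nsmul_eq_mul]
    rfl
  simp only [h2, Function.Periodic.lift_coe, zero_add] at h1
  rw [intervalIntegral.integral_ofReal] at h1
  rw [← Real.norm_eq_abs, ← Complex.norm_real]
  push_cast at h1 ⊢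
  exact h1

end Weyl

/-! ### Riemann sums over the angular grid -/

section Riemann

/-- The indices `k` of the grid angles `k * Δ` in `[-π, π]`. -/
noncomputable def angleIdx (Δ : ℝ) : Finset ℤ := Finset.Icc ⌈-Real.pi / Δ⌉ ⌊Real.pi / Δ⌋

theorem abs_mul_le_of_mem_angleIdx {Δ : ℝ} (hΔ : 0 < Δ) {k : ℤ} (hk : k ∈ angleIdx Δ) :
    |k * Δ| ≤ Real.pi := by
  rw [angleIdx, Finset.mem_Icc, Int.ceil_le, Int.le_floor, div_le_iff₀ hΔ, le_div_iff₀ hΔ] at hk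
  exact abs_le.2 ⟨hk.1, hk.2⟩

theorem ceil_le_floor_angle {Δ : ℝ} (hΔ : 0 < Δ) : ⌈-Real.pi / Δ⌉ ≤ ⌊Real.pi / Δ⌋ := by
  have hpi := Real.pi_pos
  have h1 : ⌈-Real.pi / Δ⌉ ≤ 0 := by
    rw [Int.ceil_le, Int.cast_zero]
    exact div_nonpos_of_nonpos_of_nonneg (by linarith) hΔ.le
  have h2 : 0 ≤ ⌊Real.pi / Δ⌋ := Int.floor_nonneg.2 (by positivity)
  exact h1.trans h2

theorem mul_card_angleIdx_le {Δ : ℝ} (hΔ : 0 < Δ) (hΔ1 : Δ ≤ 1) :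
    Δ * (angleIdx Δ).card ≤ 2 * Real.pi + 1 := by
  have h0 := ceil_le_floor_angle hΔ
  have h1 : ((angleIdx Δ).card : ℝ) = ⌊Real.pi / Δ⌋ + 1 - ⌈-Real.pi / Δ⌉ := by
    have : ((angleIdx Δ).card : ℤ) = ⌊Real.pi / Δ⌋ + 1 - ⌈-Real.pi / Δ⌉ := by
      rw [angleIdx, Int.card_Icc, Int.toNat_of_nonneg (by linarith)]
    exact_mod_cast this
  have h2 := mul_le_mul_of_nonneg_left (Int.floor_le (Real.pi / Δ)) hΔ.le
  have h3 := mul_le_mul_of_nonneg_left (Int.le_ceil (-Real.pi / Δ)) hΔ.le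
  rw [mul_div_cancel₀ _ hΔ.ne'] at h2 h3
  rw [h1, mul_sub, mul_add]
  linarith

theorem sum_Icc_shift_one (F : ℤ → ℝ) {a b : ℤ} (hab : a ≤ b) :
    ∑ k ∈ Finset.Icc a b, F (k + 1) = ∑ k ∈ Finset.Icc a b, F k + F (b + 1) - F a := by
  induction b, hab using Int.leInduction with
  | base => simp
  | succ b hab ih =>
    have h1 : Finset.Icc a (b + 1) = insert (b + 1) (Finset.Icc a b) := by
      ext k
      simp only [Finset.mem_insert, Finset.mem_Icc]
      omega
    rw [h1, Finset.sum_insert (by simp), Finset.sum_insert (by simp), ih]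
    ring

/-- Shifting the summation range by `h` changes at most `h` terms at either end. -/
theorem abs_sum_shift_sub_le (F : ℤ → ℝ) {B : ℝ} (hB : ∀ k, |F k| ≤ B) {a b : ℤ} (hab : a ≤ b)
    (h : ℕ) : |∑ k ∈ Finset.Icc a b, F (k + h) - ∑ k ∈ Finset.Icc a b, F k| ≤ 2 * h * B := by
  induction h with
  | zero => simp
  | succ h ih =>
    have h1 := sum_Icc_shift_one (fun k => F (k + h)) hab
    have h2 : ∑ k ∈ Finset.Icc a b, F (k + (h + 1 : ℕ)) =
        ∑ k ∈ Finset.Icc a b, F (k + 1 + h) :=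
      Finset.sum_congr rfl fun k _ => by
        congr 1
        push_cast
        ring
    rw [h2, h1]
    push_cast
    have h3 := abs_le.1 (hB (b + 1 + h))
    have h4 := abs_le.1 (hB (a + h))
    rw [abs_le] at ih ⊢
    constructor <;> linarith [ih.1, ih.2]

theorem abs_riemann_sub_integral_le {F : ℝ → ℝ} (hF : Continuous F) {Δ e T : ℝ} (hΔ : 0 < Δ)
    (hosc : ∀ x y, |x| ≤ T → |y| ≤ T → |x - y| ≤ Δ → |F x - F y| ≤ e) {a b : ℤ} (hab : a ≤ b)
    (ha : -T ≤ a * Δ) (hb : (b + 1) * Δ ≤ T) :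
    |Δ * ∑ k ∈ Finset.Icc a b, F (k * Δ) - ∫ x in (a * Δ)..((b + 1) * Δ), F x| ≤
      Δ * (Finset.Icc a b).card * e := by
  have hii : ∀ x y, IntervalIntegrable F volume x y := fun x y => hF.intervalIntegrable x y
  have hcell : ∀ k : ℤ, a ≤ k → k ≤ b →
      |Δ * F (k * Δ) - ∫ x in (k * Δ)..((k + 1) * Δ), F x| ≤ Δ * e := by
    intro k hk1 hk2
    have hk1' : (a : ℝ) * Δ ≤ k * Δ := mul_le_mul_of_nonneg_right (by exact_mod_cast hk1) hΔ.le
    have hk2' : ((k : ℝ) + 1) * Δ ≤ (b + 1) * Δ :=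
      mul_le_mul_of_nonneg_right (by exact_mod_cast Int.add_le_add_right hk2 1) hΔ.le
    have e1 : Δ * F (k * Δ) = ∫ _ in (k * Δ)..((k + 1) * Δ), F (k * Δ) := by
      rw [intervalIntegral.integral_const, smul_eq_mul]
      ring
    rw [e1, ← intervalIntegral.integral_sub intervalIntegrable_const (hii _ _)]
    have h1 := intervalIntegral.norm_integral_le_of_norm_le_const (a := k * Δ) (b := (k + 1) * Δ)
      (f := fun x => F (k * Δ) - F x) (C := e) (fun x hx => by
        rw [Set.uIoc_of_le (by linarith)] at hx
        refine hosc _ _ (abs_le.2 ⟨by linarith, by linarith⟩)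
          (abs_le.2 ⟨by linarith [hx.1], by linarith [hx.2]⟩) (abs_le.2 ⟨by linarith [hx.2], by
            linarith [hx.1]⟩))
    rw [show ((k : ℝ) + 1) * Δ - k * Δ = Δ by ring, abs_of_pos hΔ, mul_comm e] at h1
    exact h1
  have hsplit : ∀ c : ℤ, a ≤ c → ∫ x in (a * Δ)..((c + 1) * Δ), F x =
      ∑ k ∈ Finset.Icc a c, ∫ x in (k * Δ)..((k + 1) * Δ), F x := by
    intro c hc
    induction c, hc using Int.leInduction with
    | base => simp
    | succ c hc ih =>
      have h1 : Finset.Icc a (c + 1) = insert (c + 1) (Finset.Icc a c) := by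
        ext k
        simp only [Finset.mem_insert, Finset.mem_Icc]
        omega
      rw [h1, Finset.sum_insert (by simp), ← ih, add_comm (∫ x in _.._, F x)]
      push_cast
      exact (intervalIntegral.integral_add_adjacent_intervals (hii _ _) (hii _ _)).symm
  rw [hsplit b hab, Finset.mul_sum, ← Finset.sum_sub_distrib]
  refine (Finset.abs_sum_le_sum_abs _ _).trans ?_
  refine (Finset.sum_le_card_nsmul _ _ (Δ * e) fun k hk => ?_).trans (le_of_eq ?_)
  · rw [Finset.mem_Icc] at hk
    exact hcell k hk.1 hk.2
  · rw [nsmul_eq_mul]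
    ring

theorem tendsto_riemann {F : ℝ → ℝ} (hF : Continuous F) :
    Tendsto (fun Δ : ℝ => Δ * ∑ k ∈ angleIdx Δ, F (k * Δ)) (𝓝[>] 0)
      (𝓝 (∫ x in (-Real.pi)..Real.pi, F x)) := by
  have hpi := Real.pi_pos
  have hid : Tendsto (fun Δ : ℝ => Δ) (𝓝[>] 0) (𝓝 0) := tendsto_id.mono_left nhdsWithin_le_nhds
  have hA : Tendsto (fun Δ : ℝ => (⌈-Real.pi / Δ⌉ : ℝ) * Δ) (𝓝[>] 0) (𝓝 (-Real.pi)) := by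
    refine tendsto_of_tendsto_of_tendsto_of_le_of_le' tendsto_const_nhds
      (h := fun Δ => -Real.pi + Δ) (by simpa using tendsto_const_nhds.add hid) ?_ ?_
    · filter_upwards [self_mem_nhdsWithin] with Δ hΔ
      exact (div_le_iff₀ hΔ).1 (Int.le_ceil _)
    · filter_upwards [self_mem_nhdsWithin] with Δ (hΔ : 0 < Δ)
      have := mul_le_mul_of_nonneg_right (Int.ceil_lt_add_one (-Real.pi / Δ)).le hΔ.le
      rwa [add_mul, div_mul_cancel₀ _ hΔ.ne', one_mul] at this
  have hB : Tendsto (fun Δ : ℝ => ((⌊Real.pi / Δ⌋ : ℝ) + 1) * Δ) (𝓝[>] 0) (𝓝 Real.pi) := by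
    refine tendsto_of_tendsto_of_tendsto_of_le_of_le' tendsto_const_nhds
      (h := fun Δ => Real.pi + Δ) (by simpa using tendsto_const_nhds.add hid) ?_ ?_
    · filter_upwards [self_mem_nhdsWithin] with Δ hΔ
      exact (div_le_iff₀ hΔ).1 (Int.lt_floor_add_one _).le
    · filter_upwards [self_mem_nhdsWithin] with Δ (hΔ : 0 < Δ)
      have := mul_le_mul_of_nonneg_right (Int.floor_le (Real.pi / Δ)) hΔ.le
      rw [div_mul_cancel₀ _ hΔ.ne'] at this
      linarith
  have hint : Tendsto (fun Δ : ℝ => ∫ x in ((⌈-Real.pi / Δ⌉ : ℝ) * Δ)..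
      (((⌊Real.pi / Δ⌋ : ℝ) + 1) * Δ), F x) (𝓝[>] 0) (𝓝 (∫ x in (-Real.pi)..Real.pi, F x)) := by
    have hc : Continuous fun y : ℝ => ∫ x in (0 : ℝ)..y, F x :=
      intervalIntegral.continuous_primitive (fun a b => hF.intervalIntegrable a b) 0
    have h1 : ∀ a b : ℝ, ∫ x in a..b, F x = (∫ x in (0 : ℝ)..b, F x) - ∫ x in (0 : ℝ)..a, F x :=
      fun a b => (intervalIntegral.integral_interval_sub_left (hF.intervalIntegrable _ _)
        (hF.intervalIntegrable _ _)).symm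
    refine Tendsto.congr (fun Δ => (h1 _ _).symm) ?_
    rw [h1 (-Real.pi) Real.pi]
    exact ((hc.tendsto _).comp hB).sub ((hc.tendsto _).comp hA)
  have hdiff : Tendsto (fun Δ : ℝ => Δ * ∑ k ∈ angleIdx Δ, F (k * Δ) -
      ∫ x in ((⌈-Real.pi / Δ⌉ : ℝ) * Δ)..(((⌊Real.pi / Δ⌋ : ℝ) + 1) * Δ), F x)
      (𝓝[>] 0) (𝓝 0) := by
    rw [Metric.tendsto_nhds]
    intro e he
    have huc := (isCompact_Icc (a := -(Real.pi + 1))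
      (b := Real.pi + 1)).uniformContinuousOn_of_continuous hF.continuousOn
    set e' := e / (2 * (2 * Real.pi + 1)) with he'
    obtain ⟨d, hd, hd'⟩ := Metric.uniformContinuousOn_iff.1 huc e' (by positivity)
    filter_upwards [self_mem_nhdsWithin, hid.eventually_lt_const hd,
      hid.eventually_le_const one_pos] with Δ (hΔ : 0 < Δ) hΔd hΔ1
    have h1 := mul_le_mul_of_nonneg_right (Int.floor_le (Real.pi / Δ)) hΔ.le
    have h2 := mul_le_mul_of_nonneg_right (Int.le_ceil (-Real.pi / Δ)) hΔ.le
    rw [div_mul_cancel₀ _ hΔ.ne'] at h1 h2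
    have h3 := abs_riemann_sub_integral_le hF (e := e') (T := Real.pi + 1) hΔ
      (fun x y hx hy hxy => by
      have := hd' x (abs_le.1 hx) y (abs_le.1 hy) (hxy.trans_lt hΔd)
      exact this.le) (ceil_le_floor_angle hΔ) (by linarith) (by linarith)
    rw [dist_zero_right]
    refine h3.trans_lt ?_
    have h4 := mul_card_angleIdx_le hΔ hΔ1
    calc Δ * (Finset.Icc ⌈-Real.pi / Δ⌉ ⌊Real.pi / Δ⌋).card * e'
        ≤ (2 * Real.pi + 1) * e' := mul_le_mul_of_nonneg_right h4 (by positivity)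
      _ = e / 2 := by rw [he']; field_simp
      _ < e := half_lt_self he
  have := hdiff.add hint
  rw [zero_add] at this
  exact this.congr fun Δ => sub_add_cancel _ _

end Riemann

/-! ### Equidistribution of an oscillating argument along the grid -/

section Equidistribution

variable {G : ℝ → ℝ → ℝ}

/-- A jointly continuous function that is periodic in the second variable is uniformly continuous
as long as the first variable stays bounded. -/
theorem periodic_uniformContinuous (hG : Continuous (Function.uncurry G))
    (hper : ∀ α, Function.Periodic (G α) 1) (T : ℝ) {e : ℝ} (he : 0 < e) :
    ∃ d > 0, ∀ α α' a a', |α| ≤ T → |α'| ≤ T → |α - α'| < d → |a - a'| < d →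
      |G α a - G α' a'| < e := by
  have huc := ((isCompact_Icc (a := -T) (b := T)).prod
    (isCompact_Icc (a := (-1 : ℝ)) (b := 2))).uniformContinuousOn_of_continuous hG.continuousOn
  obtain ⟨d, hd, hd'⟩ := Metric.uniformContinuousOn_iff.1 huc e he
  refine ⟨min d 1, lt_min hd one_pos, fun α α' a a' hα hα' h1 h2 => ?_⟩
  have e1 : G α a = G α (a - ⌊a⌋) := by
    have := (hper α).sub_zsmul_eq (x := a) ⌊a⌋
    simpa using this.symm
  have e2 : G α' a' = G α' (a' - ⌊a⌋) := by
    have := (hper α').sub_zsmul_eq (x := a') ⌊a⌋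
    simpa using this.symm
  have h3 := Int.floor_le a
  have h4 := Int.lt_floor_add_one a
  have h5 := abs_lt.1 (h2.trans_le (min_le_right _ _))
  have := hd' (α, a - ⌊a⌋) ⟨abs_le.1 hα, by constructor <;> linarith⟩ (α', a' - ⌊a⌋)
    ⟨abs_le.1 hα', by constructor <;> linarith [h5.1, h5.2]⟩ (by
      rw [Prod.dist_eq, max_lt_iff, Real.dist_eq, Real.dist_eq]
      refine ⟨h1.trans_le (min_le_left _ _), ?_⟩
      rw [sub_sub_sub_cancel_right]
      exact h2.trans_le (min_le_left _ _))
  rw [e1, e2]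
  exact this

/-- The deviation of the Birkhoff average over `H` steps of the rotation by `v α` from the mean. -/
noncomputable def birkhoffDev (G : ℝ → ℝ → ℝ) (v : ℝ → ℝ) (H : ℕ) (α a : ℝ) : ℝ :=
  (H : ℝ)⁻¹ * ∑ h ∈ Finset.range H, G α (a + h * v α) - ∫ y in (0 : ℝ)..1, G α y

/-- The supremum over a period of the deviation of the Birkhoff average from the mean. -/
noncomputable def birkhoffSup (G : ℝ → ℝ → ℝ) (v : ℝ → ℝ) (H : ℕ) (α : ℝ) : ℝ :=
  sSup ((fun a => |birkhoffDev G v H α a|) '' Set.Icc 0 1)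

variable {v : ℝ → ℝ}

theorem continuous_mean (hG : Continuous (Function.uncurry G)) :
    Continuous fun α => ∫ y in (0 : ℝ)..1, G α y :=
  intervalIntegral.continuous_parametric_intervalIntegral_of_continuous' hG 0 1

theorem continuous_birkhoffDev (hG : Continuous (Function.uncurry G)) (hv : Continuous v) (H : ℕ) :
    Continuous fun p : ℝ × ℝ => |birkhoffDev G v H p.1 p.2| := by
  have h1 : ∀ h : ℕ, Continuous fun p : ℝ × ℝ => G p.1 (p.2 + h * v p.1) := fun h =>
    hG.comp (f := fun p : ℝ × ℝ => (p.1, p.2 + h * v p.1)) (by fun_prop)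
  exact ((continuous_const.mul (continuous_finsetSum _ fun h _ => h1 h)).sub
    ((continuous_mean hG).comp continuous_fst)).abs

theorem continuous_birkhoffSup (hG : Continuous (Function.uncurry G)) (hv : Continuous v) (H : ℕ) :
    Continuous (birkhoffSup G v H) :=
  IsCompact.continuous_sSup isCompact_Icc (continuous_birkhoffDev hG hv H)

theorem abs_birkhoffDev_le_sup (hG : Continuous (Function.uncurry G)) (hv : Continuous v)
    (hper : ∀ α, Function.Periodic (G α) 1) (H : ℕ) (α a : ℝ) :
    |birkhoffDev G v H α a| ≤ birkhoffSup G v H α := by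
  have h1 : birkhoffDev G v H α a = birkhoffDev G v H α (a - ⌊a⌋) := by
    simp only [birkhoffDev]
    congr 2
    refine Finset.sum_congr rfl fun h _ => ?_
    have := (hper α).sub_zsmul_eq (x := a + h * v α) ⌊a⌋
    rw [← this]
    congr 1
    rw [zsmul_eq_mul, mul_one]
    ring
  rw [h1]
  refine le_csSup ?_ ⟨a - ⌊a⌋, ⟨by linarith [Int.floor_le a], by
    linarith [Int.lt_floor_add_one a]⟩, rfl⟩
  exact (isCompact_Icc.image (f := fun a => |birkhoffDev G v H α a|)
    ((continuous_birkhoffDev hG hv H).comp (by fun_prop : Continuous fun a : ℝ => (α, a)))).bddAbove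

theorem birkhoffSup_le {H : ℕ} {α c : ℝ} (h : ∀ a, |birkhoffDev G v H α a| ≤ c) :
    birkhoffSup G v H α ≤ c := by
  refine csSup_le ((Set.nonempty_Icc.2 zero_le_one).image _) ?_
  rintro _ ⟨a, _, rfl⟩
  exact h a

theorem birkhoffSup_nonneg (H : ℕ) (α : ℝ) : 0 ≤ birkhoffSup G v H α := by
  refine Real.sSup_nonneg ?_
  rintro _ ⟨a, _, rfl⟩
  exact abs_nonneg _

theorem abs_birkhoffDev_le {B : ℝ} (hB : ∀ α a, |G α a| ≤ B) (H : ℕ) (α a : ℝ) :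
    |birkhoffDev G v H α a| ≤ 2 * B := by
  have hB0 : 0 ≤ B := (abs_nonneg _).trans (hB 0 0)
  have h1 : |(H : ℝ)⁻¹ * ∑ h ∈ Finset.range H, G α (a + h * v α)| ≤ B := by
    rcases Nat.eq_zero_or_pos H with rfl | hH
    · simpa using hB0
    · have hH' : (0 : ℝ) < H := by exact_mod_cast hH
      rw [abs_mul, abs_inv, Nat.abs_cast, inv_mul_le_iff₀ hH']
      refine (Finset.abs_sum_le_sum_abs _ _).trans ((Finset.sum_le_card_nsmul _ _ B
        fun h _ => hB _ _).trans ?_)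
      simp
  have h2 : |∫ y in (0 : ℝ)..1, G α y| ≤ B := by
    have := intervalIntegral.norm_integral_le_of_norm_le_const (a := (0 : ℝ)) (b := 1) (f := G α)
      (C := B) fun y _ => hB α y
    simpa using this
  exact (abs_sub _ _).trans (by linarith)

theorem tendsto_integral_birkhoffSup (hG : Continuous (Function.uncurry G)) (hv : Continuous v)
    (hper : ∀ α, Function.Periodic (G α) 1) {B : ℝ} (hB : ∀ α a, |G α a| ≤ B)
    (hirr : ∀ᵐ α, Irrational (v α)) :
    Tendsto (fun H : ℕ => ∫ α in (-Real.pi)..Real.pi, birkhoffSup G v H α) atTop (𝓝 0) := by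
  rw [show (0 : ℝ) = ∫ _ in (-Real.pi)..Real.pi, (0 : ℝ) by simp]
  refine intervalIntegral.tendsto_integral_filter_of_dominated_convergence (fun _ => 2 * B)
    (Eventually.of_forall fun H => (continuous_birkhoffSup hG hv H).aestronglyMeasurable)
    (Eventually.of_forall fun H => ae_of_all _ fun α _ => ?_) intervalIntegrable_const ?_
  · rw [Real.norm_eq_abs, abs_of_nonneg (birkhoffSup_nonneg H α)]
    exact birkhoffSup_le fun a => abs_birkhoffDev_le hB H α a
  · filter_upwards [hirr] with α hα _
    rw [Metric.tendsto_nhds]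
    intro e he
    have hc : Continuous (G α) := hG.comp (by fun_prop : Continuous fun a : ℝ => (α, a))
    filter_upwards [weyl_uniform hα hc (hper α) (half_pos he)] with H hH
    rw [Real.dist_eq, sub_zero, abs_of_nonneg (birkhoffSup_nonneg H α)]
    exact (birkhoffSup_le hH).trans_lt (half_lt_self he)

/-- Averages over the grid of a function periodic in the fast variable `(u α - p) / ε` converge to
the average over both variables. A shift `k ↦ k + h` of the grid rotates the fast variable by
nearly `h * (κ * u' α)`, so that the sum may be replaced by a sum of Birkhoff averages. -/
theorem tendsto_grid_average (hG : Continuous (Function.uncurry G))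
    (hper : ∀ α, Function.Periodic (G α) 1) {B : ℝ} (hB : ∀ α a, |G α a| ≤ B)
    {u u' : ℝ → ℝ} (hu' : Continuous u') {C : ℝ}
    (hu : ∀ α t, |u (α + t) - u α - t * u' α| ≤ C * t ^ 2) {κ : ℝ} (hκ : 0 < κ) (p : ℝ)
    (hirr : ∀ᵐ α, Irrational (κ * u' α)) :
    Tendsto (fun ε : ℝ => κ * ε * ∑ k ∈ angleIdx (κ * ε),
        G (k * (κ * ε)) ((u (k * (κ * ε)) - p) / ε)) (𝓝[>] 0)
      (𝓝 (∫ α in (-Real.pi)..Real.pi, ∫ y in (0 : ℝ)..1, G α y)) := by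
  have hpi := Real.pi_pos
  have hB0 : 0 ≤ B := (abs_nonneg _).trans (hB 0 0)
  have hC0 : 0 ≤ C := by simpa using (abs_nonneg _).trans (hu 0 1)
  set v : ℝ → ℝ := fun α => κ * u' α with hv
  have hvc : Continuous v := by fun_prop
  have hid : Tendsto (fun ε : ℝ => ε) (𝓝[>] 0) (𝓝 0) := tendsto_id.mono_left nhdsWithin_le_nhds
  have hΔ0 : Tendsto (fun ε : ℝ => κ * ε) (𝓝[>] 0) (𝓝[>] 0) := by
    refine tendsto_nhdsWithin_iff.2 ⟨by simpa using hid.const_mul κ, ?_⟩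
    filter_upwards [self_mem_nhdsWithin] with ε hε
    exact mul_pos hκ hε
  rw [Metric.tendsto_nhds]
  intro e he
  obtain ⟨H, hH1, hHe⟩ := ((eventually_ge_atTop 1).and
    ((tendsto_integral_birkhoffSup hG hvc hper hB hirr).eventually_lt_const
      (show (0 : ℝ) < e / 4 by positivity))).exists
  have hH0 : (0 : ℝ) < H := by exact_mod_cast hH1
  set e' := e / (4 * (2 * Real.pi + 1)) with he'
  have he'0 : 0 < e' := by positivity
  obtain ⟨d, hd, hd'⟩ := periodic_uniformContinuous hG hper (Real.pi + 1) he'0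
  have hR := ((tendsto_riemann (continuous_birkhoffSup hG hvc H)).comp hΔ0).eventually_lt_const hHe
  have hM := Metric.tendsto_nhds.1 ((tendsto_riemann (continuous_mean hG)).comp hΔ0) (e / 8)
    (by linarith)
  have hs1 : ∀ᶠ ε : ℝ in 𝓝[>] 0, κ * ε * (2 * H * B) < e / 8 :=
    Tendsto.eventually_lt_const (show (0 : ℝ) < e / 8 by positivity)
      (by simpa using (hid.const_mul κ).mul_const (2 * H * B))
  have hs2 : ∀ᶠ ε : ℝ in 𝓝[>] 0, H * (κ * ε) < min d 1 :=
    Tendsto.eventually_lt_const (show (0 : ℝ) < min d 1 from lt_min hd one_pos)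
      (by simpa using (hid.const_mul κ).const_mul (H : ℝ))
  have hs3 : ∀ᶠ ε : ℝ in 𝓝[>] 0, C * (H * κ) ^ 2 * ε < d :=
    Tendsto.eventually_lt_const (show (0 : ℝ) < d from hd)
      (by simpa using hid.const_mul (C * (H * κ) ^ 2))
  filter_upwards [self_mem_nhdsWithin, hR, hM, hs1, hs2, hs3] with ε (hε : 0 < ε) hR hM hs1 hs2 hs3
  simp only [Function.comp_apply] at hR hM
  set Δ := κ * ε with hΔ
  have hΔpos : 0 < Δ := mul_pos hκ hε
  have hΔ1 : Δ ≤ 1 := by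
    have h1 : (1 : ℝ) * Δ ≤ H * Δ := mul_le_mul_of_nonneg_right (by exact_mod_cast hH1) hΔpos.le
    linarith [min_le_right d 1]
  have hcard := mul_card_angleIdx_le hΔpos hΔ1
  set F : ℤ → ℝ := fun k => G (k * Δ) ((u (k * Δ) - p) / ε) with hF
  set A := ∑ k ∈ angleIdx Δ, F k with hA
  -- Shifting the grid by `h` steps changes the sum little.
  have hshift : ∀ h ∈ Finset.range H, |∑ k ∈ angleIdx Δ, F (k + (h : ℕ)) - A| ≤ 2 * H * B := by
    intro h hh
    refine (abs_sum_shift_sub_le F (fun k => hB _ _) (ceil_le_floor_angle hΔpos) h).trans ?_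
    have : (h : ℝ) ≤ H := by exact_mod_cast (Finset.mem_range.1 hh).le
    gcongr
  -- The shifted fast variable is nearly a rotation of the original one.
  have hrot : ∀ h ∈ Finset.range H, ∀ k ∈ angleIdx Δ,
      |F (k + (h : ℕ)) - G (k * Δ) ((u (k * Δ) - p) / ε + h * v (k * Δ))| ≤ e' := by
    intro h hh k hk
    have hhH : (h : ℝ) ≤ H := by exact_mod_cast (Finset.mem_range.1 hh).le
    have hh0 : (0 : ℝ) ≤ h := Nat.cast_nonneg h
    have hk' := abs_mul_le_of_mem_angleIdx hΔpos hk
    have hhΔ : (h : ℝ) * Δ < min d 1 := (mul_le_mul_of_nonneg_right hhH hΔpos.le).trans_lt hs2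
    have hhΔ0 : 0 ≤ (h : ℝ) * Δ := by positivity
    have e1 : (((k + (h : ℕ) : ℤ) : ℝ)) * Δ = k * Δ + h * Δ := by
      push_cast
      ring
    rw [hF]
    simp only [e1]
    refine (hd' _ _ _ _ ?_ (by linarith) ?_ ?_).le
    · refine (abs_add_le _ _).trans ?_
      rw [abs_of_nonneg hhΔ0]
      linarith [min_le_right d 1]
    · rw [add_sub_cancel_left, abs_of_nonneg hhΔ0]
      exact hhΔ.trans_le (min_le_left _ _)
    · have e2 : (u (k * Δ + h * Δ) - p) / ε - ((u (k * Δ) - p) / ε + h * v (k * Δ)) =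
          (u (k * Δ + h * Δ) - u (k * Δ) - h * Δ * u' (k * Δ)) / ε := by
        rw [hv, hΔ]
        field_simp
        ring
      rw [e2, abs_div, abs_of_pos hε, div_lt_iff₀ hε]
      refine (hu _ _).trans_lt ?_
      calc C * (h * Δ) ^ 2 ≤ C * (H * Δ) ^ 2 := by gcongr
        _ = C * (H * κ) ^ 2 * ε * ε := by rw [hΔ]; ring
        _ < d * ε := mul_lt_mul_of_pos_right hs3 hε
  have hmain : H * A = ∑ h ∈ Finset.range H, (A - ∑ k ∈ angleIdx Δ, F (k + (h : ℕ))) +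
      ∑ h ∈ Finset.range H, ∑ k ∈ angleIdx Δ,
        (F (k + (h : ℕ)) - G (k * Δ) ((u (k * Δ) - p) / ε + h * v (k * Δ))) +
      H * (∑ k ∈ angleIdx Δ, birkhoffDev G v H (k * Δ) ((u (k * Δ) - p) / ε)) +
      H * ∑ k ∈ angleIdx Δ, ∫ y in (0 : ℝ)..1, G (k * Δ) y := by
    simp only [birkhoffDev, Finset.sum_sub_distrib, Finset.sum_const, Finset.card_range,
      nsmul_eq_mul, ← Finset.mul_sum]
    rw [mul_sub, mul_inv_cancel_left₀ hH0.ne', Finset.sum_comm (s := angleIdx Δ)]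
    ring
  have b1 : |∑ h ∈ Finset.range H, (A - ∑ k ∈ angleIdx Δ, F (k + (h : ℕ)))| ≤
      H * (2 * H * B) := by
    refine (Finset.abs_sum_le_sum_abs _ _).trans ((Finset.sum_le_card_nsmul _ _ (2 * H * B)
      fun h hh => by rw [abs_sub_comm]; exact hshift h hh).trans ?_)
    simp
  have b2 : |∑ h ∈ Finset.range H, ∑ k ∈ angleIdx Δ,
      (F (k + (h : ℕ)) - G (k * Δ) ((u (k * Δ) - p) / ε + h * v (k * Δ)))| ≤
      H * ((angleIdx Δ).card * e') := by
    refine (Finset.abs_sum_le_sum_abs _ _).trans ((Finset.sum_le_card_nsmul _ _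
      ((angleIdx Δ).card * e') fun h hh => ?_).trans (by simp))
    refine (Finset.abs_sum_le_sum_abs _ _).trans ((Finset.sum_le_card_nsmul _ _ e'
      fun k hk => hrot h hh k hk).trans (by simp))
  have b3 : |∑ k ∈ angleIdx Δ, birkhoffDev G v H (k * Δ) ((u (k * Δ) - p) / ε)| ≤
      ∑ k ∈ angleIdx Δ, birkhoffSup G v H (k * Δ) :=
    (Finset.abs_sum_le_sum_abs _ _).trans
      (Finset.sum_le_sum fun k _ => abs_birkhoffDev_le_sup hG hvc hper H _ _)
  have hmain' : |A - ∑ k ∈ angleIdx Δ, ∫ y in (0 : ℝ)..1, G (k * Δ) y| ≤ 2 * H * B +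
      (angleIdx Δ).card * e' + ∑ k ∈ angleIdx Δ, birkhoffSup G v H (k * Δ) := by
    rw [abs_le] at b1 b2 b3 ⊢
    constructor
    · refine le_of_mul_le_mul_left ?_ hH0
      nlinarith [b1.1, b2.1, mul_le_mul_of_nonneg_left b3.1 hH0.le]
    · refine le_of_mul_le_mul_left ?_ hH0
      nlinarith [b1.2, b2.2, mul_le_mul_of_nonneg_left b3.2 hH0.le]
  have h5 : |Δ * A - Δ * ∑ k ∈ angleIdx Δ, ∫ y in (0 : ℝ)..1, G (k * Δ) y| ≤
      Δ * (2 * H * B) + Δ * (angleIdx Δ).card * e' +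
        Δ * ∑ k ∈ angleIdx Δ, birkhoffSup G v H (k * Δ) := by
    rw [← mul_sub, abs_mul, abs_of_pos hΔpos]
    exact (mul_le_mul_of_nonneg_left hmain' hΔpos.le).trans (le_of_eq (by ring))
  have h6 : Δ * (angleIdx Δ).card * e' ≤ e / 4 := by
    refine (mul_le_mul_of_nonneg_right hcard he'0.le).trans (le_of_eq ?_)
    rw [he']
    field_simp
  rw [Real.dist_eq] at hM ⊢
  have h7 := abs_sub_le (Δ * A) (Δ * ∑ k ∈ angleIdx Δ, ∫ y in (0 : ℝ)..1, G (k * Δ) y)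
    (∫ α in (-Real.pi)..Real.pi, ∫ y in (0 : ℝ)..1, G α y)
  linarith

end Equidistribution

/-! ### Periodization -/

section Periodization

/-- Peetre's inequality. -/
theorem one_div_one_add_sq_le (x b : ℝ) :
    1 / (1 + (x + b) ^ 2) ≤ 2 * (1 + b ^ 2) * (1 / (1 + x ^ 2)) := by
  rw [mul_one_div, div_le_div_iff₀ (by positivity) (by positivity)]
  nlinarith [sq_nonneg (x + 2 * b), sq_nonneg (b * (x + b))]

theorem summable_one_div_one_add_int_sq : Summable fun j : ℤ => 1 / (1 + (j : ℝ) ^ 2) := by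
  have h1 : Summable fun j : ℤ => 1 / (j : ℝ) ^ 2 := Real.summable_one_div_int_pow.2 one_lt_two
  refine Summable.of_norm_bounded_eventually (g := fun j : ℤ => 1 / (j : ℝ) ^ 2) h1 ?_
  filter_upwards [(Set.finite_singleton (0 : ℤ)).compl_mem_cofinite] with j hj
  have hj0 : (j : ℝ) ≠ 0 := by exact_mod_cast hj
  rw [Real.norm_eq_abs, abs_of_nonneg (by positivity)]
  exact one_div_le_one_div_of_le (by positivity) (by linarith)

theorem summable_one_div_one_add_sub_sq (a : ℝ) :
    Summable fun j : ℤ => 1 / (1 + (a - j) ^ 2) := by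
  refine Summable.of_nonneg_of_le (fun j => by positivity) (fun j => ?_)
    (summable_one_div_one_add_int_sq.mul_left (2 * (1 + a ^ 2)))
  have := one_div_one_add_sq_le (-(j : ℝ)) a
  rwa [neg_sq, neg_add_eq_sub] at this

theorem tsum_sub_int_eq (f : ℝ → ℝ) (a : ℝ) (n : ℤ) :
    ∑' j : ℤ, f (a - n - j) = ∑' j : ℤ, f (a - j) := by
  rw [← (Equiv.addRight n).tsum_eq fun j : ℤ => f (a - j)]
  congr 1
  ext j
  congr 1
  simp
  ring

/-- The sums over the translates of `ℤ` are bounded uniformly, since `a` may be taken in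
`[0, 1)`. -/
theorem exists_tsum_bound : ∃ C₀ > 0, ∀ a : ℝ, ∑' j : ℤ, 1 / (1 + (a - j) ^ 2) ≤ C₀ := by
  set A := ∑' j : ℤ, 1 / (1 + (j : ℝ) ^ 2) with hA
  have hA0 : 0 ≤ A := tsum_nonneg fun j => by positivity
  refine ⟨4 * A + 1, by positivity, fun a => ?_⟩
  rw [← tsum_sub_int_eq (fun r => 1 / (1 + r ^ 2)) a ⌊a⌋]
  have h0 : 0 ≤ a - ⌊a⌋ := sub_nonneg.2 (Int.floor_le a)
  have h1 : a - ⌊a⌋ ≤ 1 := by linarith [Int.lt_floor_add_one a]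
  have h2 : ∀ j : ℤ, 1 / (1 + (a - ⌊a⌋ - j) ^ 2) ≤ 4 * (1 / (1 + (j : ℝ) ^ 2)) := by
    intro j
    have := one_div_one_add_sq_le (-(j : ℝ)) (a - ⌊a⌋)
    rw [neg_sq, neg_add_eq_sub] at this
    refine this.trans (mul_le_mul_of_nonneg_right ?_ (by positivity))
    nlinarith
  have h3 := (summable_one_div_one_add_sub_sq (a - ⌊a⌋)).tsum_le_tsum h2
    (summable_one_div_one_add_int_sq.mul_left 4)
  rw [tsum_mul_left] at h3
  linarith

/-- The periodization of `Q α` with period one. -/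
noncomputable def periodize (Q : ℝ → ℝ → ℝ) (α a : ℝ) : ℝ := ∑' j : ℤ, Q α (a - j)

variable {Q : ℝ → ℝ → ℝ} {C : ℝ}

theorem periodic_periodize (Q : ℝ → ℝ → ℝ) (α : ℝ) : Function.Periodic (periodize Q α) 1 := by
  intro a
  have := tsum_sub_int_eq (Q α) (a + 1) 1
  simpa [periodize] using this.symm

theorem summable_periodize (hC : ∀ α r, |Q α r| ≤ C * (1 / (1 + r ^ 2))) (α a : ℝ) :
    Summable fun j : ℤ => Q α (a - j) :=
  Summable.of_norm_bounded ((summable_one_div_one_add_sub_sq a).mul_left C) fun _ => hC _ _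

theorem continuous_periodize (hQ : Continuous (Function.uncurry Q)) (hC0 : 0 ≤ C)
    (hC : ∀ α r, |Q α r| ≤ C * (1 / (1 + r ^ 2))) :
    Continuous (Function.uncurry (periodize Q)) := by
  refine continuous_iff_continuousAt.2 fun q => ?_
  have hU : {p : ℝ × ℝ | |p.2| < |q.2| + 1} ∈ 𝓝 q :=
    (isOpen_lt (by fun_prop) (by fun_prop)).mem_nhds (by simp)
  refine ContinuousOn.continuousAt (s := {p : ℝ × ℝ | |p.2| < |q.2| + 1}) ?_ hU
  refine continuousOn_tsum (u := fun j : ℤ =>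
    C * (2 * (1 + (|q.2| + 1) ^ 2) * (1 / (1 + (j : ℝ) ^ 2)))) (fun j => ?_)
    ((summable_one_div_one_add_int_sq.mul_left _).mul_left _) (fun j p hp => ?_)
  · exact (hQ.comp (f := fun p : ℝ × ℝ => (p.1, p.2 - j)) (by fun_prop)).continuousOn
  · refine (hC _ _).trans (mul_le_mul_of_nonneg_left ?_ hC0)
    have h1 := one_div_one_add_sq_le (-(j : ℝ)) p.2
    rw [neg_sq, neg_add_eq_sub] at h1
    refine h1.trans (mul_le_mul_of_nonneg_right ?_ (by positivity))
    have h2 : p.2 ^ 2 ≤ (|q.2| + 1) ^ 2 := by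
      rw [← sq_abs p.2]
      exact pow_le_pow_left₀ (abs_nonneg _) (le_of_lt hp) 2
    linarith

theorem abs_tsum_le_of_decay {f : ℤ → ℝ} {a c C₀ : ℝ}
    (hC₀ : ∑' j : ℤ, 1 / (1 + (a - j) ^ 2) ≤ C₀) (hc : 0 ≤ c)
    (hf : ∀ j : ℤ, |f j| ≤ c * (1 / (1 + (a - j) ^ 2))) : |∑' j, f j| ≤ c * C₀ := by
  have h1 : |∑' j, f j| ≤ _ := tsum_of_norm_bounded (f := f)
    ((summable_one_div_one_add_sub_sq a).mul_left c).hasSum hf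
  rw [tsum_mul_left] at h1
  exact h1.trans (mul_le_mul_of_nonneg_left hC₀ hc)

/-- Grid sums of a kernel concentrated near the curve `p = u α`: in the `p` direction the
coefficient `s` is frozen on the curve. -/
theorem tendsto_grid_sum (hQ : Continuous (Function.uncurry Q)) (hC0 : 0 ≤ C)
    (hC : ∀ α r, |Q α r| * (1 + |r|) ≤ C * (1 / (1 + r ^ 2)))
    {s : ℝ → ℝ → ℝ} (hs : Continuous (Function.uncurry s)) {B L : ℝ} (hB : ∀ α p, |s α p| ≤ B)
    (hL : ∀ α p p', |s α p - s α p'| ≤ L * |p - p'|)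
    {u u' : ℝ → ℝ} (huc : Continuous u) (hu' : Continuous u') {D : ℝ}
    (hu : ∀ α t, |u (α + t) - u α - t * u' α| ≤ D * t ^ 2) {κ : ℝ} (hκ : 0 < κ) (pbar : ℝ)
    (hirr : ∀ᵐ α, Irrational (κ * u' α)) :
    Tendsto (fun ε : ℝ => κ * ε * ∑ k ∈ angleIdx (κ * ε), ∑' j : ℤ,
        Q (k * (κ * ε)) ((u (k * (κ * ε)) - pbar) / ε - j) * s (k * (κ * ε)) (pbar + j * ε))
      (𝓝[>] 0)
      (𝓝 (∫ α in (-Real.pi)..Real.pi, s α (u α) * ∫ y in (0 : ℝ)..1, periodize Q α y)) := by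
  have hC' : ∀ α r, |Q α r| ≤ C * (1 / (1 + r ^ 2)) := fun α r =>
    (le_mul_of_one_le_right (abs_nonneg _) (by linarith [abs_nonneg r])).trans (hC α r)
  have hB0 : 0 ≤ B := (abs_nonneg _).trans (hB 0 0)
  have hL0 : 0 ≤ L := by simpa using (abs_nonneg _).trans (hL 0 1 0)
  obtain ⟨C₀, hC₀, hC₀'⟩ := exists_tsum_bound
  have hid : Tendsto (fun ε : ℝ => ε) (𝓝[>] 0) (𝓝 0) := tendsto_id.mono_left nhdsWithin_le_nhds
  have hmain := tendsto_grid_average (G := fun α a => s α (u α) * periodize Q α a)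
    (((hs.comp (f := fun p : ℝ × ℝ => (p.1, u p.1)) (by fun_prop))).mul
      (continuous_periodize hQ hC0 hC'))
    (fun α a => by simp only [periodic_periodize Q α a]) (B := B * (C * C₀)) (fun α a => by
      rw [abs_mul]
      exact mul_le_mul (hB _ _) (abs_tsum_le_of_decay (hC₀' a) hC0 fun j => hC' _ _)
        (abs_nonneg _) hB0) hu' hu hκ pbar hirr
  simp only [intervalIntegral.integral_const_mul] at hmain
  refine hmain.congr_dist (squeeze_zero' (Eventually.of_forall fun ε => dist_nonneg)
    (g := fun ε => (2 * Real.pi + 1) * (L * ε * C * C₀)) ?_ ?_)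
  · filter_upwards [self_mem_nhdsWithin,
      (show Tendsto (fun ε : ℝ => κ * ε) (𝓝[>] 0) (𝓝 0) by
        simpa using hid.const_mul κ).eventually_le_const one_pos] with ε (hε : 0 < ε) hε1
    have hΔ : 0 < κ * ε := mul_pos hκ hε
    rw [Real.dist_eq, ← mul_sub, ← Finset.sum_sub_distrib, abs_mul, abs_of_pos hΔ]
    have hterm : ∀ k ∈ angleIdx (κ * ε), |s (k * (κ * ε)) (u (k * (κ * ε))) *
        periodize Q (k * (κ * ε)) ((u (k * (κ * ε)) - pbar) / ε) - ∑' j : ℤ,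
        Q (k * (κ * ε)) ((u (k * (κ * ε)) - pbar) / ε - j) * s (k * (κ * ε)) (pbar + j * ε)| ≤
        L * ε * C * C₀ := by
      intro k _
      set α := k * (κ * ε)
      set a := (u α - pbar) / ε with ha
      have hsum := summable_periodize hC' α a
      have hsum2 : Summable fun j : ℤ => Q α (a - j) * s α (pbar + j * ε) := by
        refine Summable.of_norm_bounded (hsum.abs.mul_right B) fun j => ?_
        rw [norm_mul]
        exact mul_le_mul_of_nonneg_left (hB _ _) (norm_nonneg _)
      rw [periodize, ← tsum_mul_left, ← (hsum.mul_left _).tsum_sub hsum2]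
      refine abs_tsum_le_of_decay (hC₀' a) (by positivity) fun j => ?_
      have e1 : s α (u α) * Q α (a - j) - Q α (a - j) * s α (pbar + j * ε) =
          Q α (a - j) * (s α (u α) - s α (pbar + j * ε)) := by ring
      have e2 : u α - (pbar + j * ε) = ε * (a - j) := by
        rw [ha]
        field_simp
        ring
      have h1 := hL α (u α) (pbar + j * ε)
      rw [e2, abs_mul, abs_of_pos hε] at h1
      rw [e1, abs_mul]
      have h2 := hC α (a - j)
      have h3 := abs_nonneg (Q α (a - j))
      calc |Q α (a - j)| * |s α (u α) - s α (pbar + j * ε)|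
          ≤ |Q α (a - j)| * (L * (ε * (1 + |a - j|))) := by
            refine mul_le_mul_of_nonneg_left (h1.trans ?_) h3
            gcongr
            linarith
        _ = L * ε * (|Q α (a - j)| * (1 + |a - j|)) := by ring
        _ ≤ L * ε * (C * (1 / (1 + (a - j) ^ 2))) := by gcongr
        _ = _ := by ring
    have hE : 0 ≤ L * ε * C * C₀ := by positivity
    calc κ * ε * |_| ≤ κ * ε * ((angleIdx (κ * ε)).card * (L * ε * C * C₀)) := by
          refine mul_le_mul_of_nonneg_left ?_ hΔ.le
          exact (Finset.abs_sum_le_sum_abs _ _).trans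
            ((Finset.sum_le_card_nsmul _ _ _ hterm).trans (by simp))
      _ = κ * ε * (angleIdx (κ * ε)).card * (L * ε * C * C₀) := by ring
      _ ≤ _ := mul_le_mul_of_nonneg_right (mul_card_angleIdx_le hΔ hε1) hE
  · have := (((hid.const_mul L).mul_const C).mul_const C₀).const_mul (2 * Real.pi + 1)
    simpa using this

end Periodization

/-! ### Truncation to the grid `|p_j| ≤ P` -/

section Truncation

/-- The indices `j` of the grid offsets `pbar + j * ε` in `[-P, P]`. -/
noncomputable def offsetIdx (pbar P ε : ℝ) : Finset ℤ :=
  Finset.Icc ⌈(-P - pbar) / ε⌉ ⌊(P - pbar) / ε⌋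

theorem mem_offsetIdx {pbar P ε : ℝ} (hε : 0 < ε) (j : ℤ) :
    j ∈ offsetIdx pbar P ε ↔ |pbar + j * ε| ≤ P := by
  rw [offsetIdx, Finset.mem_Icc, Int.ceil_le, Int.le_floor, div_le_iff₀ hε, le_div_iff₀ hε, abs_le]
  constructor <;> rintro ⟨h1, h2⟩ <;> constructor <;> linarith

/-- A Lipschitz cutoff, which approximates the indicator function of `[-P, P]` for large `n`: from
below for `b = 0`, and from above for `b = 1`. -/
noncomputable def cutoff (P : ℝ) (n : ℕ) (b p : ℝ) : ℝ := max 0 (min 1 (n * (P - |p|) + b))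

theorem cutoff_nonneg (P : ℝ) (n : ℕ) (b p : ℝ) : 0 ≤ cutoff P n b p := le_max_left _ _

theorem cutoff_le_one (P : ℝ) (n : ℕ) (b p : ℝ) : cutoff P n b p ≤ 1 :=
  max_le zero_le_one (min_le_left _ _)

theorem continuous_cutoff (P : ℝ) (n : ℕ) (b : ℝ) : Continuous (cutoff P n b) := by
  unfold cutoff
  fun_prop

theorem cutoff_one_eq_one {P : ℝ} (n : ℕ) {p : ℝ} (hp : |p| ≤ P) : cutoff P n 1 p = 1 := by
  have : (0 : ℝ) ≤ n * (P - |p|) := mul_nonneg (Nat.cast_nonneg n) (sub_nonneg.2 hp)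
  rw [cutoff, min_eq_left (by linarith), max_eq_right zero_le_one]

theorem cutoff_zero_eq_zero {P : ℝ} (n : ℕ) {p : ℝ} (hp : P < |p|) : cutoff P n 0 p = 0 := by
  have : n * (P - |p|) ≤ 0 :=
    mul_nonpos_of_nonneg_of_nonpos (Nat.cast_nonneg n) (sub_nonpos.2 hp.le)
  rw [cutoff, max_eq_left]
  exact (min_le_right _ _).trans (by linarith)

theorem abs_cutoff_sub_le (P : ℝ) (n : ℕ) (b p p' : ℝ) :
    |cutoff P n b p - cutoff P n b p'| ≤ n * |p - p'| := by
  have h1 : ∀ x y : ℝ, |max 0 (min 1 x) - max 0 (min 1 y)| ≤ |x - y| := by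
    intro x y
    have h2 := abs_max_sub_max_le_max (0 : ℝ) (min 1 x) 0 (min 1 y)
    have h3 := abs_min_sub_min_le_max (1 : ℝ) x 1 y
    rw [sub_self, abs_zero, max_eq_right (abs_nonneg (min 1 x - min 1 y))] at h2
    rw [sub_self, abs_zero, max_eq_right (abs_nonneg (x - y))] at h3
    exact h2.trans h3
  refine (h1 _ _).trans ?_
  rw [show (n : ℝ) * (P - |p|) + b - (n * (P - |p'|) + b) = n * (|p'| - |p|) by ring, abs_mul,
    Nat.abs_cast, abs_sub_comm p p']
  exact mul_le_mul_of_nonneg_left (abs_abs_sub_abs_le_abs_sub _ _) (Nat.cast_nonneg n)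

theorem tendsto_cutoff {P p : ℝ} (b : ℝ) (hp : |p| ≠ P) :
    Tendsto (fun n : ℕ => cutoff P n b p) atTop (𝓝 (if |p| ≤ P then 1 else 0)) := by
  split_ifs with h
  · have h1 : 0 < P - |p| := sub_pos.2 (lt_of_le_of_ne h hp)
    have h2 : Tendsto (fun n : ℕ => (n : ℝ) * (P - |p|) + b) atTop atTop :=
      tendsto_atTop_add_const_right _ _ (tendsto_natCast_atTop_atTop.atTop_mul_const h1)
    refine tendsto_const_nhds.congr' ?_
    filter_upwards [h2.eventually_ge_atTop 1] with n hn
    rw [cutoff, min_eq_left hn, max_eq_right zero_le_one]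
  · have h1 : P - |p| < 0 := sub_neg.2 (not_le.1 h)
    have h2 : Tendsto (fun n : ℕ => (n : ℝ) * (P - |p|) + b) atTop atBot :=
      tendsto_atBot_add_const_right _ _ (tendsto_natCast_atTop_atTop.atTop_mul_const_of_neg h1)
    refine tendsto_const_nhds.congr' ?_
    filter_upwards [h2.eventually_le_atBot 0] with n hn
    rw [cutoff, max_eq_left ((min_le_right _ _).trans hn)]

variable {Q : ℝ → ℝ → ℝ} {C : ℝ}

/-- The limit of the grid sums when the offsets are restricted to `[-P, P]`. The restriction is
squeezed between two Lipschitz cutoffs; the jump at `|p| = P` matters only where `|u α| = P`. -/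
theorem tendsto_truncated_grid_sum (hQ : Continuous (Function.uncurry Q)) (hC0 : 0 ≤ C)
    (hQ0 : ∀ α r, 0 ≤ Q α r) (hC : ∀ α r, |Q α r| * (1 + |r|) ≤ C * (1 / (1 + r ^ 2)))
    {s : ℝ → ℝ → ℝ} (hs : Continuous (Function.uncurry s)) {B L : ℝ} (hs0 : ∀ α p, 0 ≤ s α p)
    (hB : ∀ α p, |s α p| ≤ B) (hL : ∀ α p p', |s α p - s α p'| ≤ L * |p - p'|)
    {u u' : ℝ → ℝ} (huc : Continuous u) (hu' : Continuous u') {D : ℝ}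
    (hu : ∀ α t, |u (α + t) - u α - t * u' α| ≤ D * t ^ 2) {κ : ℝ} (hκ : 0 < κ) (pbar : ℝ)
    (hirr : ∀ᵐ α, Irrational (κ * u' α)) {P : ℝ} (hP : ∀ᵐ α, |u α| ≠ P) :
    Tendsto (fun ε : ℝ => κ * ε * ∑ k ∈ angleIdx (κ * ε), ∑ j ∈ offsetIdx pbar P ε,
        Q (k * (κ * ε)) ((u (k * (κ * ε)) - pbar) / ε - j) * s (k * (κ * ε)) (pbar + j * ε))
      (𝓝[>] 0)
      (𝓝 (∫ α in (-Real.pi)..Real.pi, (if |u α| ≤ P then 1 else 0) * s α (u α) *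
        ∫ y in (0 : ℝ)..1, periodize Q α y)) := by
  have hC' : ∀ α r, |Q α r| ≤ C * (1 / (1 + r ^ 2)) := fun α r =>
    (le_mul_of_one_le_right (abs_nonneg _) (by linarith [abs_nonneg r])).trans (hC α r)
  have hB0 : 0 ≤ B := (abs_nonneg _).trans (hB 0 0)
  have hL0 : 0 ≤ L := by simpa using (abs_nonneg _).trans (hL 0 1 0)
  have hcb : ∀ n b α p, |cutoff P n b p * s α p| ≤ B := fun n b α p => by
    rw [abs_mul, abs_of_nonneg (cutoff_nonneg _ _ _ _)]
    exact (mul_le_of_le_one_left (abs_nonneg _) (cutoff_le_one _ _ _ _)).trans (hB _ _)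
  have hlim : ∀ (n : ℕ) (b : ℝ), _ := fun n b =>
    tendsto_grid_sum hQ hC0 hC (s := fun α p => cutoff P n b p * s α p)
      (((continuous_cutoff P n b).comp continuous_snd).mul hs) (B := B) (L := L + B * n)
      (hcb n b) (fun α p p' => by
        have e1 : cutoff P n b p * s α p - cutoff P n b p' * s α p' =
            cutoff P n b p * (s α p - s α p') + (cutoff P n b p - cutoff P n b p') * s α p' := by
          ring
        rw [e1, add_mul]
        refine (abs_add_le _ _).trans (add_le_add ?_ ?_)
        · rw [abs_mul, abs_of_nonneg (cutoff_nonneg _ _ _ _)]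
          exact (mul_le_of_le_one_left (abs_nonneg _) (cutoff_le_one _ _ _ _)).trans (hL _ _ _)
        · rw [abs_mul, mul_comm, mul_assoc]
          exact mul_le_mul (hB _ _) (abs_cutoff_sub_le _ _ _ _ _) (abs_nonneg _) hB0)
      huc hu' hu hκ pbar hirr
  have hcont : Continuous fun α => ∫ y in (0 : ℝ)..1, periodize Q α y :=
    continuous_mean (continuous_periodize hQ hC0 hC')
  have hInt : ∀ b : ℝ, Tendsto (fun n : ℕ => ∫ α in (-Real.pi)..Real.pi,
      cutoff P n b (u α) * s α (u α) * ∫ y in (0 : ℝ)..1, periodize Q α y) atTop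
      (𝓝 (∫ α in (-Real.pi)..Real.pi, (if |u α| ≤ P then 1 else 0) * s α (u α) *
        ∫ y in (0 : ℝ)..1, periodize Q α y)) := by
    intro b
    refine intervalIntegral.tendsto_integral_filter_of_dominated_convergence
      (fun α => B * |∫ y in (0 : ℝ)..1, periodize Q α y|)
      (Eventually.of_forall fun n => ?_)
      (Eventually.of_forall fun n => ae_of_all _ fun α _ => ?_)
      ((continuous_const.mul hcont.abs).intervalIntegrable _ _) ?_
    · exact ((((continuous_cutoff P n b).comp huc).mul
        (hs.comp (f := fun α => (α, u α)) (by fun_prop))).mul hcont).aestronglyMeasurable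
    · rw [norm_mul]
      exact mul_le_mul_of_nonneg_right (hcb n b _ _) (norm_nonneg _)
    · filter_upwards [hP] with α hα _
      exact ((tendsto_cutoff b hα).mul_const _).mul_const _
  rw [tendsto_order]
  constructor
  · intro c hc
    obtain ⟨n, hn⟩ := ((hInt 0).eventually_const_lt hc).exists
    filter_upwards [(hlim n 0).eventually_const_lt hn, self_mem_nhdsWithin] with ε h1 (hε : 0 < ε)
    refine h1.trans_le ?_
    have hΔ : 0 < κ * ε := mul_pos hκ hε
    refine mul_le_mul_of_nonneg_left (Finset.sum_le_sum fun k _ => ?_) hΔ.le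
    rw [tsum_eq_sum (s := offsetIdx pbar P ε)]
    · refine Finset.sum_le_sum fun j _ => mul_le_mul_of_nonneg_left ?_ (hQ0 _ _)
      exact mul_le_of_le_one_left (hs0 _ _) (cutoff_le_one _ _ _ _)
    · intro j hj
      rw [mem_offsetIdx hε, not_le] at hj
      rw [cutoff_zero_eq_zero n hj]
      ring
  · intro c hc
    obtain ⟨n, hn⟩ := ((hInt 1).eventually_lt_const hc).exists
    filter_upwards [(hlim n 1).eventually_lt_const hn, self_mem_nhdsWithin] with ε h1 (hε : 0 < ε)
    refine lt_of_le_of_lt ?_ h1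
    have hΔ : 0 < κ * ε := mul_pos hκ hε
    refine mul_le_mul_of_nonneg_left (Finset.sum_le_sum fun k _ => ?_) hΔ.le
    refine le_trans (Finset.sum_le_sum (g := fun j : ℤ => Q (k * (κ * ε))
      ((u (k * (κ * ε)) - pbar) / ε - j) * (cutoff P n 1 (pbar + j * ε) *
        s (k * (κ * ε)) (pbar + j * ε))) fun j hj => ?_)
      (Summable.sum_le_tsum _ (fun j _ => mul_nonneg (hQ0 _ _)
        (mul_nonneg (cutoff_nonneg _ _ _ _) (hs0 _ _))) ?_)
    · rw [mem_offsetIdx hε] at hj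
      rw [cutoff_one_eq_one n hj, one_mul]
    · refine Summable.of_norm_bounded ((summable_periodize hC' (k * (κ * ε))
        ((u (k * (κ * ε)) - pbar) / ε)).abs.mul_right B) fun j => ?_
      rw [norm_mul]
      exact mul_le_mul_of_nonneg_left (hcb _ _ _ _) (norm_nonneg _)

end Truncation

/-! ### The function `α ↦ (cos α, sin α) · x` -/

section Trigonometric

/-- A nontrivial combination of `cos` and `sin` is a shifted multiple of `cos`, so its level sets
are countable. -/
theorem ae_cos_add_sin_ne {a b : ℝ} (hab : a ≠ 0 ∨ b ≠ 0) (c : ℝ) :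
    ∀ᵐ α : ℝ, a * Real.cos α + b * Real.sin α ≠ c := by
  set z : ℂ := ⟨a, b⟩ with hz
  have hz0 : z ≠ 0 := by
    intro h
    have h1 : a = 0 := congrArg Complex.re h
    have h2 : b = 0 := congrArg Complex.im h
    rcases hab with h3 | h3 <;> contradiction
  have hform : ∀ α, a * Real.cos α + b * Real.sin α = ‖z‖ * Real.cos (α - z.arg) := by
    intro α
    have h1 : ‖z‖ * Real.cos z.arg = a := Complex.norm_mul_cos_arg z
    have h2 : ‖z‖ * Real.sin z.arg = b := Complex.norm_mul_sin_arg z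
    rw [Real.cos_sub, ← h1, ← h2]
    ring
  have hcount : {α : ℝ | a * Real.cos α + b * Real.sin α = c}.Countable := by
    rcases Set.eq_empty_or_nonempty {α : ℝ | a * Real.cos α + b * Real.sin α = c} with he | ⟨α₀, h₀⟩
    · rw [he]
      exact Set.countable_empty
    · refine ((Set.countable_range fun k : ℤ => 2 * k * Real.pi + (α₀ - z.arg) + z.arg).union
        (Set.countable_range fun k : ℤ => 2 * k * Real.pi - (α₀ - z.arg) + z.arg)).mono ?_
      intro α hα
      have h1 : Real.cos (α₀ - z.arg) = Real.cos (α - z.arg) := by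
        refine mul_left_cancel₀ (norm_ne_zero_iff.2 hz0) ?_
        rw [← hform, ← hform]
        exact Eq.trans h₀ (Eq.symm hα)
      obtain ⟨k, hk | hk⟩ := Real.cos_eq_cos_iff.1 h1
      · exact Or.inl ⟨k, by simp only; linarith⟩
      · exact Or.inr ⟨k, by simp only; linarith⟩
  have := hcount.measure_zero volume
  rw [ae_iff]
  simpa using this

theorem proj_eq (α : ℝ) (x : Plane) : proj α x = x 0 * Real.cos α + x 1 * Real.sin α := by
  simp [proj, dir, PiLp.inner_apply, Fin.sum_univ_two]

theorem ae_proj_ne {x : Plane} (hx : x ≠ 0) (c : ℝ) : ∀ᵐ α : ℝ, proj α x ≠ c := by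
  simp_rw [proj_eq]
  refine ae_cos_add_sin_ne ?_ c
  by_contra! h
  refine hx ?_
  ext i
  fin_cases i
  · exact h.1
  · exact h.2

theorem continuous_proj (x : Plane) : Continuous fun α => proj α x := by
  simp_rw [proj_eq]
  fun_prop

theorem abs_proj_le (α : ℝ) (x : Plane) : |proj α x| ≤ ‖x‖ := by
  have h1 : ‖dir α‖ = 1 := by
    simp [dir, EuclideanSpace.norm_eq, Fin.sum_univ_two]
  have := abs_real_inner_le_norm (dir α) x
  rwa [h1, one_mul] at this

/-- The derivative of `α ↦ (cos α, sin α) · x`. -/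
noncomputable def projDeriv (x : Plane) (α : ℝ) : ℝ := x 1 * Real.cos α - x 0 * Real.sin α

theorem continuous_projDeriv (x : Plane) : Continuous (projDeriv x) := by
  unfold projDeriv
  fun_prop

theorem abs_sin_sub_self_le (t : ℝ) : |Real.sin t - t| ≤ 2 * t ^ 2 := by
  rcases le_or_gt |t| 1 with h | h
  · have h1 := abs_le.1 (Real.sin_bound h)
    have h0 := abs_nonneg t
    have h2 : |t| ^ 4 ≤ t ^ 2 := by
      rw [← sq_abs t]
      exact pow_le_pow_of_le_one h0 h (by norm_num)
    have h3 : |t ^ 3| ≤ t ^ 2 := by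
      rw [abs_pow, ← sq_abs t]
      exact pow_le_pow_of_le_one h0 h (by norm_num)
    have h4 := abs_le.1 h3
    rw [abs_le]
    constructor <;> nlinarith [h1.1, h1.2, h4.1, h4.2]
  · have h1 : |Real.sin t| ≤ |t| := Real.abs_sin_le_abs
    have h2 := abs_sub (Real.sin t) t
    rw [← sq_abs t]
    nlinarith

/-- First-order Taylor expansion with a uniform remainder. -/
theorem abs_proj_add_sub_le (x : Plane) (α t : ℝ) :
    |proj (α + t) x - proj α x - t * projDeriv x α| ≤ (3 * (|x 0| + |x 1|)) * t ^ 2 := by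
  have hc : |Real.cos t - 1| ≤ t ^ 2 := by
    have h1 := Real.one_sub_sq_div_two_le_cos (x := t)
    have h2 := Real.cos_le_one t
    rw [abs_le]
    constructor <;> nlinarith [sq_nonneg t]
  have hs := abs_sin_sub_self_le t
  have e1 : proj (α + t) x - proj α x - t * projDeriv x α =
      (x 0 * Real.cos α + x 1 * Real.sin α) * (Real.cos t - 1) +
        (x 1 * Real.cos α - x 0 * Real.sin α) * (Real.sin t - t) := by
    rw [proj_eq, proj_eq, projDeriv, Real.cos_add, Real.sin_add]
    ring
  have hcs : ∀ a b : ℝ, ∀ y z : ℝ, |y| ≤ 1 → |z| ≤ 1 → |a * y + b * z| ≤ |a| + |b| := by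
    intro a b y z hy hz
    refine (abs_add_le _ _).trans (add_le_add ?_ ?_)
    · rw [abs_mul]
      exact mul_le_of_le_one_right (abs_nonneg _) hy
    · rw [abs_mul]
      exact mul_le_of_le_one_right (abs_nonneg _) hz
  have h1 := hcs (x 0) (x 1) _ _ (Real.abs_cos_le_one α) (Real.abs_sin_le_one α)
  have h2 := hcs (x 1) (-x 0) _ _ (Real.abs_cos_le_one α) (Real.abs_sin_le_one α)
  rw [abs_neg, neg_mul, ← sub_eq_add_neg] at h2
  rw [e1]
  refine (abs_add_le _ _).trans ?_
  rw [abs_mul, abs_mul]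
  have h3 := mul_le_mul h1 hc (abs_nonneg _) (by positivity)
  have h4 := mul_le_mul h2 hs (abs_nonneg _) (by positivity)
  linarith

theorem ae_irrational_mul_projDeriv {x : Plane} (hx : x ≠ 0) {κ : ℝ} (hκ : κ ≠ 0) :
    ∀ᵐ α : ℝ, Irrational (κ * projDeriv x α) := by
  have h1 : ∀ q : ℚ, ∀ᵐ α : ℝ, κ * projDeriv x α ≠ q := by
    intro q
    have h2 : (κ * x 1 ≠ 0 ∨ -(κ * x 0) ≠ 0) := by
      by_contra! h
      refine hx ?_
      ext i
      fin_cases i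
      · simpa [hκ] using h.2
      · simpa [hκ] using h.1
    filter_upwards [ae_cos_add_sin_ne h2 q] with α hα h3
    refine hα (Eq.trans ?_ h3)
    rw [projDeriv]
    ring
  filter_upwards [ae_all_iff.2 h1] with α hα
  rintro ⟨q, hq⟩
  exact hα q hq.symm

theorem ae_abs_proj_ne {x : Plane} (hx : x ≠ 0) (P : ℝ) : ∀ᵐ α : ℝ, |proj α x| ≠ P := by
  filter_upwards [ae_proj_ne hx P, ae_proj_ne hx (-P)] with α h1 h2 h3
  rcases abs_choice (proj α x) with h | h
  · exact h1 (h ▸ h3)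
  · exact h2 (by linarith)

theorem ae_injective_proj {K : ℕ} {x : Fin K → Plane} (hx : Function.Injective x) :
    ∀ᵐ α : ℝ, Function.Injective fun i => proj α (x i) := by
  have h1 : ∀ i j : Fin K, ∀ᵐ α : ℝ, i ≠ j → proj α (x i) ≠ proj α (x j) := by
    intro i j
    by_cases hij : i = j
    · exact ae_of_all _ fun α h => absurd hij h
    · filter_upwards [ae_proj_ne (sub_ne_zero.2 (hx.ne hij)) 0] with α hα _ h
      refine hα ?_
      rw [proj, inner_sub_right]
      exact sub_eq_zero.2 h
  filter_upwards [ae_all_iff.2 fun i => ae_all_iff.2 (h1 i)] with α hα i j h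
  by_contra hij
  exact hα i j hij h

end Trigonometric

/-! ### The kernel `H φ'` and the weights -/

section Kernel

theorem KernelAssumption.exists_support_bound {M : ℕ} {φ : ℝ → ℝ} (hφ : KernelAssumption M φ) :
    ∃ R, ∀ s, R < |s| → deriv φ s = 0 := by
  obtain ⟨R, hR⟩ := hφ.compact_support.deriv.isCompact.isBounded.subset_closedBall 0
  refine ⟨R, fun s hs => ?_⟩
  by_contra hc
  have h1 := hR (subset_tsupport _ (Function.mem_support.2 hc))
  rw [mem_closedBall_zero_iff, Real.norm_eq_abs] at h1
  linarith

theorem KernelAssumption.contDiff_deriv {M : ℕ} {φ : ℝ → ℝ} (hφ : KernelAssumption M φ) :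
    ContDiff ℝ 1 (deriv φ) := by
  have h1 : ContDiff ℝ 2 φ := hφ.contDiff.of_le (by
    exact_mod_cast (by have := hφ.three_le; omega : 2 ≤ M))
  exact ((contDiff_succ_iff_deriv (n := 1)).1 h1).2.2

theorem KernelAssumption.exists_lipschitz {M : ℕ} {φ : ℝ → ℝ} (hφ : KernelAssumption M φ) :
    ∃ L, LipschitzWith L (deriv φ) :=
  ContDiff.lipschitzWith_of_hasCompactSupport hφ.compact_support.deriv hφ.contDiff_deriv
    one_ne_zero

theorem KernelAssumption.differentiable {M : ℕ} {φ : ℝ → ℝ} (hφ : KernelAssumption M φ) :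
    Differentiable ℝ φ :=
  hφ.contDiff.differentiable (by
    exact_mod_cast (by have := hφ.three_le; omega : M ≠ 0))

theorem KernelAssumption.integral_deriv {M : ℕ} {φ : ℝ → ℝ} (hφ : KernelAssumption M φ) :
    ∫ s, deriv φ s = 0 :=
  integral_eq_zero_of_hasDerivAt_of_integrable (f := φ)
    (fun x => (hφ.differentiable x).hasDerivAt)
    (hφ.contDiff_deriv.continuous.integrable_of_hasCompactSupport hφ.compact_support.deriv)
    (hφ.differentiable.continuous.integrable_of_hasCompactSupport hφ.compact_support)

theorem KernelAssumption.deriv_ne_zero {M : ℕ} {φ : ℝ → ℝ} (hφ : KernelAssumption M φ) :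
    deriv φ ≠ 0 := by
  intro h
  have hconst : ∀ x y, φ x = φ y :=
    is_const_of_deriv_eq_zero hφ.differentiable fun x => congrFun h x
  have h0 : ∀ x, φ x = 0 := by
    obtain ⟨R, hR⟩ := hφ.compact_support.isCompact.isBounded.subset_closedBall 0
    have h1 : φ (|R| + 1) = 0 := by
      by_contra hc
      have h2 := hR (subset_tsupport _ (Function.mem_support.2 hc))
      rw [mem_closedBall_zero_iff, Real.norm_eq_abs, abs_of_nonneg (by positivity)] at h2
      linarith [le_abs_self R]
    exact fun x => (hconst x _).trans h1
  have := hφ.integral_eq_one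
  simp [h0] at this

/-- The weight of a noise variable, as a function of the angle `α` and of the signed distance `r`,
in units of the step size, from the grid point to the line through `x₀`. -/
noncomputable def lineWeight (g : ℝ → ℝ) {K : ℕ} (xc : Fin K → Plane) (θ : Fin K → ℝ)
    (α r : ℝ) : ℝ := ∑ i, θ i * g (r + proj α (xc i))

variable {g : ℝ → ℝ} {K : ℕ} {xc : Fin K → Plane} {θ : Fin K → ℝ}

theorem continuous_lineWeight (hg : Continuous g) :
    Continuous fun p : ℝ × ℝ => lineWeight g xc θ p.1 p.2 := by
  unfold lineWeight
  refine continuous_finsetSum _ fun i _ => continuous_const.mul (hg.comp ?_)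
  exact continuous_snd.add ((continuous_proj (xc i)).comp continuous_fst)

theorem exists_lineWeight_bound {C : ℝ} (hC : ∀ t, |g t| ≤ C / (1 + t ^ 2)) :
    ∃ C₁ > 0, ∀ α r, |lineWeight g xc θ α r| ≤ C₁ * (1 / (1 + r ^ 2)) := by
  have hC0 : 0 ≤ C := by simpa using (abs_nonneg _).trans (hC 0)
  refine ⟨∑ i, |θ i| * (C * (2 * (1 + ‖xc i‖ ^ 2))) + 1, by positivity, fun α r => ?_⟩
  rw [add_mul, Finset.sum_mul]
  refine le_trans (b := ∑ i, |θ i| * (C * (2 * (1 + ‖xc i‖ ^ 2))) * (1 / (1 + r ^ 2))) ?_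
    (le_add_of_nonneg_right (by positivity))
  refine (Finset.abs_sum_le_sum_abs _ _).trans (Finset.sum_le_sum fun i _ => ?_)
  rw [abs_mul, mul_assoc]
  refine mul_le_mul_of_nonneg_left ?_ (abs_nonneg _)
  have h1 := one_div_one_add_sq_le r (proj α (xc i))
  have h2 : proj α (xc i) ^ 2 ≤ ‖xc i‖ ^ 2 := by
    rw [← sq_abs]
    exact pow_le_pow_left₀ (abs_nonneg _) (abs_proj_le _ _) 2
  calc |g (r + proj α (xc i))| ≤ C * (1 / (1 + (r + proj α (xc i)) ^ 2)) := by
        rw [mul_one_div]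
        exact hC _
    _ ≤ C * (2 * (1 + ‖xc i‖ ^ 2) * (1 / (1 + r ^ 2))) := by
        refine mul_le_mul_of_nonneg_left (h1.trans ?_) hC0
        gcongr
    _ = _ := by ring

theorem sq_mul_one_add_abs_le {w r C : ℝ} (hw : |w| ≤ C * (1 / (1 + r ^ 2))) :
    |w ^ 2| * (1 + |r|) ≤ 2 * C ^ 2 * (1 / (1 + r ^ 2)) := by
  have h1 : 0 < 1 + r ^ 2 := by positivity
  have h2 : 1 + |r| ≤ 2 * (1 + r ^ 2) := by
    rw [← sq_abs r]
    nlinarith [sq_nonneg (|r| - 1)]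
  rw [abs_pow]
  calc |w| ^ 2 * (1 + |r|) ≤ (C * (1 / (1 + r ^ 2))) ^ 2 * (2 * (1 + r ^ 2)) := by gcongr
    _ = _ := by field_simp

theorem cube_le_of_decay {w r C : ℝ} (hC : 0 ≤ C) (hw : |w| ≤ C * (1 / (1 + r ^ 2))) :
    |w| ^ 3 ≤ C ^ 3 * (1 / (1 + r ^ 2)) := by
  have h0 : 0 ≤ 1 / (1 + r ^ 2) := by positivity
  have h1 : 1 / (1 + r ^ 2) ≤ 1 := by
    rw [div_le_one (by positivity)]
    nlinarith
  calc |w| ^ 3 ≤ (C * (1 / (1 + r ^ 2))) ^ 3 := by gcongr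
    _ = C ^ 3 * (1 / (1 + r ^ 2)) ^ 3 := by ring
    _ ≤ _ := mul_le_mul_of_nonneg_left (pow_le_of_le_one h0 h1 (by norm_num)) (by positivity)

end Kernel

/-! ### The variance of the noise, extended to the plane -/

section Clamp

/-- The nearest point of `[-a, a]`. -/
noncomputable def clamp (a x : ℝ) : ℝ := max (-a) (min a x)

theorem clamp_mem {a : ℝ} (ha : 0 ≤ a) (x : ℝ) : clamp a x ∈ Set.Icc (-a) a :=
  ⟨le_max_left _ _, max_le (by linarith) (min_le_left _ _)⟩

theorem clamp_eq {a x : ℝ} (hx : |x| ≤ a) : clamp a x = x := by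
  rw [clamp, min_eq_right (abs_le.1 hx).2, max_eq_right (abs_le.1 hx).1]

theorem continuous_clamp (a : ℝ) : Continuous (clamp a) := by
  unfold clamp
  fun_prop

theorem abs_clamp_sub_le (a x y : ℝ) : |clamp a x - clamp a y| ≤ |x - y| := by
  have h2 := abs_max_sub_max_le_max (-a) (min a x) (-a) (min a y)
  have h3 := abs_min_sub_min_le_max a x a y
  rw [sub_self, abs_zero, max_eq_right (abs_nonneg (min a x - min a y))] at h2
  rw [sub_self, abs_zero, max_eq_right (abs_nonneg (x - y))] at h3
  exact h2.trans h3

/-- The noise variance `σ²`, extended from `[-π, π] × [-P, P]` to the plane. -/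
noncomputable def noiseVar (P : ℝ) (σ : ℝ × ℝ → ℝ) (α p : ℝ) : ℝ :=
  σ (clamp Real.pi α, clamp P p) ^ 2

variable {P : ℝ} {σ : ℝ × ℝ → ℝ}

theorem noiseVar_eq {α p : ℝ} (hα : |α| ≤ Real.pi) (hp : |p| ≤ P) :
    noiseVar P σ α p = σ (α, p) ^ 2 := by
  rw [noiseVar, clamp_eq hα, clamp_eq hp]

theorem continuous_noiseVar (hP : 0 ≤ P)
    (hσ : ContDiffOn ℝ 1 σ (Set.Icc (-Real.pi) Real.pi ×ˢ Set.Icc (-P) P)) :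
    Continuous (Function.uncurry (noiseVar P σ)) := by
  refine Continuous.pow ?_ 2
  exact hσ.continuousOn.comp_continuous
    (((continuous_clamp _).comp continuous_fst).prodMk ((continuous_clamp _).comp continuous_snd))
    fun q => ⟨clamp_mem Real.pi_pos.le _, clamp_mem hP _⟩

theorem exists_noiseVar_bound (hP : 0 ≤ P)
    (hσ : ContDiffOn ℝ 1 σ (Set.Icc (-Real.pi) Real.pi ×ˢ Set.Icc (-P) P)) :
    ∃ B, ∀ α p, |noiseVar P σ α p| ≤ B := by
  obtain ⟨B, hB⟩ := (isCompact_Icc.prod isCompact_Icc).exists_bound_of_continuousOn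
    hσ.continuousOn
  refine ⟨B ^ 2, fun α p => ?_⟩
  rw [noiseVar, abs_pow]
  exact pow_le_pow_left₀ (abs_nonneg _)
    (hB _ ⟨clamp_mem Real.pi_pos.le _, clamp_mem hP _⟩) 2

theorem exists_noiseVar_lipschitz (hP : 0 ≤ P)
    (hσ : ContDiffOn ℝ 1 σ (Set.Icc (-Real.pi) Real.pi ×ˢ Set.Icc (-P) P)) :
    ∃ L, ∀ α p p', |noiseVar P σ α p - noiseVar P σ α p'| ≤ L * |p - p'| := by
  obtain ⟨B, hB⟩ := (isCompact_Icc.prod isCompact_Icc).exists_bound_of_continuousOn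
    hσ.continuousOn
  obtain ⟨L, hL⟩ := hσ.exists_lipschitzOnWith one_ne_zero
    ((convex_Icc _ _).prod (convex_Icc _ _)) (isCompact_Icc.prod isCompact_Icc)
  refine ⟨2 * B * L, fun α p p' => ?_⟩
  have hm : ∀ p, (clamp Real.pi α, clamp P p) ∈
      Set.Icc (-Real.pi) Real.pi ×ˢ Set.Icc (-P) P :=
    fun p => ⟨clamp_mem Real.pi_pos.le _, clamp_mem hP _⟩
  have h1 := hL.dist_le_mul _ (hm p) _ (hm p')
  rw [Prod.dist_eq, dist_self, max_eq_right dist_nonneg, Real.dist_eq, Real.dist_eq] at h1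
  have h2 : |σ (clamp Real.pi α, clamp P p) + σ (clamp Real.pi α, clamp P p')| ≤ 2 * B := by
    have h3 := hB _ (hm p)
    have h4 := hB _ (hm p')
    rw [Real.norm_eq_abs] at h3 h4
    exact (abs_add_le _ _).trans (by linarith)
  have h5 : |σ (clamp Real.pi α, clamp P p) - σ (clamp Real.pi α, clamp P p')| ≤ L * |p - p'| :=
    h1.trans (mul_le_mul_of_nonneg_left (abs_clamp_sub_le _ _ _) L.2)
  rw [noiseVar, noiseVar, sq_sub_sq, abs_mul, mul_assoc]
  exact mul_le_mul h2 h5 (abs_nonneg _) ((abs_nonneg _).trans h2)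

end Clamp

/-! ### The moment sums -/

section Moments

/-- The mean of the periodization is the integral of `Q α` over the line; only its positivity is
needed. -/
theorem integral_periodize_pos {Q : ℝ → ℝ → ℝ} {C : ℝ} (hQ : Continuous (Function.uncurry Q))
    (hC0 : 0 ≤ C) (hQ0 : ∀ α r, 0 ≤ Q α r) (hC : ∀ α r, |Q α r| ≤ C * (1 / (1 + r ^ 2)))
    {α r : ℝ} (hr : Q α r ≠ 0) : 0 < ∫ y in (0 : ℝ)..1, periodize Q α y := by
  have hpos : ∀ a, 0 ≤ periodize Q α a := fun a => tsum_nonneg fun j => hQ0 _ _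
  refine intervalIntegral.integral_pos zero_lt_one
    ((continuous_periodize hQ hC0 hC).comp
      (by fun_prop : Continuous fun a : ℝ => (α, a))).continuousOn (fun a _ => hpos a)
    ⟨r - ⌊r⌋, ⟨by linarith [Int.floor_le r], by linarith [Int.lt_floor_add_one r]⟩, ?_⟩
  have h1 : Q α (r - ⌊r⌋ - (-⌊r⌋ : ℤ)) ≤ periodize Q α (r - ⌊r⌋) :=
    (summable_periodize hC α (r - ⌊r⌋)).le_tsum (-⌊r⌋) fun j _ => hQ0 _ _
  have h2 : r - ⌊r⌋ - ((-⌊r⌋ : ℤ) : ℝ) = r := by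
    push_cast
    ring
  rw [h2] at h1
  exact (lt_of_le_of_ne (hQ0 _ _) hr.symm).trans_le h1

variable {S : Type*} [MeasurableSpace S] {μ : Measure S} {κ pbar P : ℝ} {σ : ℝ × ℝ → ℝ}
  {η : ℝ → ℤ → ℤ → S → ℝ}

theorem weight_eq_lineWeight (κ pbar : ℝ) (φ : ℝ → ℝ) (x₀ : Plane) {K : ℕ} (xc : Fin K → Plane)
    (θ : Fin K → ℝ) (ε : ℝ) (k j : ℤ) :
    weight κ pbar φ x₀ xc θ ε (k, j) = lineWeight (hilbert (deriv φ)) xc θ (k * (κ * ε))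
      ((proj (k * (κ * ε)) x₀ - pbar) / ε - j) := rfl

theorem varianceSum_eq (hκ : 0 < κ) (hη : NoiseAssumption μ κ pbar P σ η) (φ : ℝ → ℝ)
    (x₀ : Plane) {K : ℕ} (xc : Fin K → Plane) (θ : Fin K → ℝ) {ε : ℝ} (hε : 0 < ε) :
    varianceSum μ κ pbar P φ η x₀ xc θ ε = κ * ε * ∑ k ∈ angleIdx (κ * ε),
      ∑ j ∈ offsetIdx pbar P ε, lineWeight (hilbert (deriv φ)) xc θ (k * (κ * ε))
        ((proj (k * (κ * ε)) x₀ - pbar) / ε - j) ^ 2 *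
          noiseVar P σ (k * (κ * ε)) (pbar + j * ε) := by
  have h1 : grid κ pbar P ε = angleIdx (κ * ε) ×ˢ offsetIdx pbar P ε := rfl
  rw [varianceSum, h1, Finset.sum_product, Finset.mul_sum]
  refine Finset.sum_congr rfl fun k hk => ?_
  rw [Finset.mul_sum]
  refine Finset.sum_congr rfl fun j hj => ?_
  have hq : (k, j) ∈ grid κ pbar P ε := by
    rw [h1]
    exact Finset.mk_mem_product hk hj
  have h2 := (mem_grid hκ hε (k, j)).1 hq
  rw [weight_eq_lineWeight, hη.second_moment ε hε (k, j) hq, ← noiseVar_eq h2.1 h2.2]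
  simp only [angle, offset, dAlpha]
  ring

theorem variance_xi_eq [IsProbabilityMeasure μ] (hη : NoiseAssumption μ κ pbar P σ η) (φ : ℝ → ℝ)
    (x₀ : Plane) {K : ℕ} (xc : Fin K → Plane) (θ : Fin K → ℝ) {ε : ℝ} (hε : 0 < ε) :
    Var[xi κ pbar P φ η x₀ xc θ ε; μ] =
      (κ / (4 * Real.pi)) ^ 2 * varianceSum μ κ pbar P φ η x₀ xc θ ε := by
  set X : grid κ pbar P ε → S → ℝ := fun q => η ε q.1.1 q.1.2 with hX
  set w : grid κ pbar P ε → ℝ := fun q => weight κ pbar φ x₀ xc θ ε q.1 with hw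
  have hL2 : ∀ q, MemLp (X q) 2 μ := fun q => (hη.memLp ε hε q.1 q.2).mono_exponent (by norm_num)
  have e1 : xi κ pbar P φ η x₀ xc θ ε = fun ω => -(κ / (4 * Real.pi)) *
      (∑ q : grid κ pbar P ε, fun ω => w q * X q ω) ω := by
    funext ω
    rw [xi_eq κ pbar P φ η x₀ xc θ hε ω, Finset.sum_apply]
    congr 1
    exact (Finset.sum_coe_sort (grid κ pbar P ε) fun q => weight κ pbar φ x₀ xc θ ε q *
      η ε q.1 q.2 ω).symm
  have e2 : ∀ q, Var[fun ω => w q * X q ω; μ] = w q ^ 2 * ∫ ω, X q ω ^ 2 ∂μ := by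
    intro q
    rw [variance_const_mul, variance_of_integral_eq_zero (hL2 q).aestronglyMeasurable.aemeasurable
      (hη.mean ε hε q.1 q.2)]
  rw [e1, variance_const_mul, IndepFun.variance_sum (fun q _ => (hL2 q).const_mul (w q)) ?_,
    neg_sq, varianceSum]
  · simp_rw [e2]
    congr 1
    exact Finset.sum_coe_sort (grid κ pbar P ε) fun q => weight κ pbar φ x₀ xc θ ε q ^ 2 *
      ∫ ω, η ε q.1 q.2 ω ^ 2 ∂μ
  · intro q _ q' _ hqq
    exact ((hη.indep ε hε).indepFun hqq).comp (measurable_const_mul (w q))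
      (measurable_const_mul (w q'))

/-- The third moments contribute `Δα ^ (3/2)` per angle, of which there are about `2π / Δα`; the sum
over the offsets is bounded by the decay of the weights. -/
theorem exists_thirdMomentSum_le (hκ : 0 < κ) (hη : NoiseAssumption μ κ pbar P σ η) (φ : ℝ → ℝ)
    (x₀ : Plane) {K : ℕ} (xc : Fin K → Plane) (θ : Fin K → ℝ) {C : ℝ} (hC0 : 0 ≤ C)
    (hC : ∀ α r, |lineWeight (hilbert (deriv φ)) xc θ α r| ≤ C * (1 / (1 + r ^ 2))) :
    ∃ A, 0 ≤ A ∧ ∀ ε > 0, κ * ε ≤ 1 →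
      thirdMomentSum μ κ pbar P φ η x₀ xc θ ε ≤ A * ε ^ (1 / 2 : ℝ) := by
  obtain ⟨c, hc, hc'⟩ := hη.third_moment
  obtain ⟨C₀, hC₀, hC₀'⟩ := exists_tsum_bound
  have hpi := Real.pi_pos
  refine ⟨(2 * Real.pi + 1) * (C ^ 3 * C₀) * c * κ ^ (1 / 2 : ℝ), by positivity,
    fun ε hε hε1 => ?_⟩
  have hΔ : 0 < κ * ε := mul_pos hκ hε
  have h1 : grid κ pbar P ε = angleIdx (κ * ε) ×ˢ offsetIdx pbar P ε := rfl
  have h2 : thirdMomentSum μ κ pbar P φ η x₀ xc θ ε ≤ ∑ q ∈ grid κ pbar P ε,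
      |weight κ pbar φ x₀ xc θ ε q| ^ 3 * (c * (κ * ε) ^ (3 / 2 : ℝ)) :=
    Finset.sum_le_sum fun q hq => mul_le_mul_of_nonneg_left (hc' ε hε q hq) (by positivity)
  have h3 : ∑ q ∈ grid κ pbar P ε, |weight κ pbar φ x₀ xc θ ε q| ^ 3 ≤
      (angleIdx (κ * ε)).card * (C ^ 3 * C₀) := by
    rw [h1, Finset.sum_product]
    refine (Finset.sum_le_card_nsmul _ _ (C ^ 3 * C₀) fun k _ => ?_).trans (by simp)
    set a := (proj (k * (κ * ε)) x₀ - pbar) / ε with ha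
    refine (Finset.sum_le_sum (g := fun j : ℤ => C ^ 3 * (1 / (1 + (a - j) ^ 2)))
      fun j _ => ?_).trans (((summable_one_div_one_add_sub_sq a).mul_left
        (C ^ 3)).sum_le_tsum _ (fun j _ => by positivity) |>.trans ?_)
    · exact cube_le_of_decay hC0 (hC _ _)
    · rw [tsum_mul_left]
      exact mul_le_mul_of_nonneg_left (hC₀' a) (by positivity)
  have h4 : (κ * ε) ^ (3 / 2 : ℝ) = κ * ε * (κ ^ (1 / 2 : ℝ) * ε ^ (1 / 2 : ℝ)) := by
    rw [← Real.mul_rpow hκ.le hε.le, show (3 / 2 : ℝ) = 1 + 1 / 2 by norm_num,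
      Real.rpow_add hΔ, Real.rpow_one]
  rw [← Finset.sum_mul] at h2
  calc thirdMomentSum μ κ pbar P φ η x₀ xc θ ε
      ≤ (angleIdx (κ * ε)).card * (C ^ 3 * C₀) * (c * (κ * ε) ^ (3 / 2 : ℝ)) :=
        h2.trans (mul_le_mul_of_nonneg_right h3 (by positivity))
    _ = κ * ε * (angleIdx (κ * ε)).card *
        ((C ^ 3 * C₀) * c * (κ ^ (1 / 2 : ℝ) * ε ^ (1 / 2 : ℝ))) := by
        rw [h4]
        ring
    _ ≤ (2 * Real.pi + 1) * ((C ^ 3 * C₀) * c * (κ ^ (1 / 2 : ℝ) * ε ^ (1 / 2 : ℝ))) :=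
        mul_le_mul_of_nonneg_right (mul_card_angleIdx_le hΔ hε1) (by positivity)
    _ = _ := by ring

/-- The variance sum converges to the integral over the angles of `σ²` on the curve of lines
through `x₀`, times the mean square weight. The integrand vanishes only for exceptional angles,
because the translates of `H φ'` are linearly independent. -/
theorem tendsto_varianceSum (hκ : 0 < κ) (hP : 0 < P) (hη : NoiseAssumption μ κ pbar P σ η)
    {M : ℕ} {φ : ℝ → ℝ} (hφ : KernelAssumption M φ) {ν : ℝ} {x₀ : Plane}
    (hx₀ : CenterAssumption κ P σ ν x₀) {K : ℕ} {xc : Fin K → Plane}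
    (hxc : Function.Injective xc) {θ : Fin K → ℝ} (hθ : θ ≠ 0) {C : ℝ}
    (hC : ∀ α r, |lineWeight (hilbert (deriv φ)) xc θ α r| ≤ C * (1 / (1 + r ^ 2))) :
    ∃ V > 0, Tendsto (varianceSum μ κ pbar P φ η x₀ xc θ) (𝓝[>] 0) (𝓝 V) := by
  have hpi := Real.pi_pos
  -- `κ * ‖x₀‖` is irrational, so `x₀` is not the origin.
  have hx0 : x₀ ≠ 0 := by
    rintro rfl
    exact hx₀.type.irrational.ne_zero (by simp)
  obtain ⟨R, hR⟩ := hφ.exists_support_bound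
  obtain ⟨Lφ, hLφ⟩ := hφ.exists_lipschitz
  have hg := continuous_hilbert hLφ hR
  obtain ⟨B, hB⟩ := exists_noiseVar_bound hP.le hη.contDiff_sigma
  obtain ⟨L, hL⟩ := exists_noiseVar_lipschitz hP.le hη.contDiff_sigma
  have hs := continuous_noiseVar hP.le hη.contDiff_sigma
  set Q : ℝ → ℝ → ℝ := fun α r => lineWeight (hilbert (deriv φ)) xc θ α r ^ 2 with hQdef
  have hQ : Continuous (Function.uncurry Q) := (continuous_lineWeight hg).pow 2
  have hQ0 : ∀ α r, 0 ≤ Q α r := fun α r => sq_nonneg _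
  have hQC : ∀ α r, |Q α r| * (1 + |r|) ≤ 2 * C ^ 2 * (1 / (1 + r ^ 2)) := fun α r =>
    sq_mul_one_add_abs_le (hC α r)
  have hQC' : ∀ α r, |Q α r| ≤ 2 * C ^ 2 * (1 / (1 + r ^ 2)) := fun α r =>
    (le_mul_of_one_le_right (abs_nonneg _) (by linarith [abs_nonneg r])).trans (hQC α r)
  have hlim := tendsto_truncated_grid_sum hQ (by positivity) hQ0 hQC hs
    (fun α p => sq_nonneg _) hB hL (continuous_proj x₀) (continuous_projDeriv x₀)
    (abs_proj_add_sub_le x₀) hκ pbar (ae_irrational_mul_projDeriv hx0 hκ.ne')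
    (ae_abs_proj_ne hx0 P)
  refine ⟨_, ?_, hlim.congr' ?_⟩
  · set m : ℝ → ℝ := fun α => ∫ y in (0 : ℝ)..1, periodize Q α y with hm
    have hmc : Continuous m := continuous_mean (continuous_periodize hQ (by positivity) hQC')
    have hm0 : ∀ α, 0 ≤ m α := fun α => intervalIntegral.integral_nonneg zero_le_one
      fun a _ => tsum_nonneg fun j => hQ0 _ _
    set f : ℝ → ℝ := fun α => (if |proj α x₀| ≤ P then 1 else 0) *
      noiseVar P σ α (proj α x₀) * m α with hf
    have hf0 : ∀ α, 0 ≤ f α := fun α => mul_nonneg (mul_nonneg (by split_ifs <;> norm_num)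
      (sq_nonneg _)) (hm0 α)
    have hfi : IntervalIntegrable f volume (-Real.pi) Real.pi := by
      have hc : Continuous fun α => noiseVar P σ α (proj α x₀) * m α :=
        (hs.comp (f := fun α => (α, proj α x₀))
          (continuous_id.prodMk (continuous_proj x₀))).mul hmc
      have e1 : f = {α | |proj α x₀| ≤ P}.indicator
          fun α => noiseVar P σ α (proj α x₀) * m α := by
        funext α
        by_cases h : |proj α x₀| ≤ P <;> simp [hf, Set.indicator, h]
      rw [e1, intervalIntegrable_iff]
      exact (intervalIntegrable_iff.1 (hc.intervalIntegrable _ _)).indicator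
        (measurableSet_le (continuous_proj x₀).abs.measurable measurable_const)
    refine (intervalIntegral.integral_pos_iff_support_of_nonneg_ae (ae_of_all _ hf0) hfi).2
      ⟨by linarith, ?_⟩
    obtain ⟨O, hO, hOne, hOsub, hOσ⟩ := hx₀.nondegenerate
    -- The integrand is nonzero at every angle of `O` at which the lines through the points
    -- `xc i` in the direction orthogonal to `dir α` are distinct.
    refine (hO.measure_pos volume hOne).trans_le (measure_mono_ae ?_)
    filter_upwards [ae_injective_proj hxc, Measure.ae_ne volume (-Real.pi)] with α hα hαpi hαO
    obtain ⟨h1, h2⟩ := hOσ α hαO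
    have h3 := hOsub hαO
    refine ⟨?_, lt_of_le_of_ne h3.1 hαpi.symm, h3.2⟩
    have h4 : ∃ r, Q α r ≠ 0 := by
      by_contra! hc
      refine hθ (hilbert_translates_linearIndependent hφ.contDiff_deriv.continuous hR
        hφ.deriv_ne_zero hα fun t => ?_)
      exact pow_eq_zero_iff two_ne_zero |>.1 (hc t)
    obtain ⟨r, hr⟩ := h4
    have h5 := integral_periodize_pos hQ (by positivity) hQ0 hQC' hr
    rw [Function.mem_support, hf]
    simp only [h1, if_true, one_mul]
    rw [noiseVar_eq (abs_le.2 h3) h1]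
    exact mul_ne_zero h2 h5.ne'
  · filter_upwards [self_mem_nhdsWithin] with ε hε
    exact (varianceSum_eq hκ hη φ x₀ xc θ hε).symm

end Moments

end FBPNoise

theorem mainTheorem2 {S : Type*} [MeasurableSpace S] (μ : Measure S) [IsProbabilityMeasure μ]
    (κ pbar P ν : ℝ) (hκ : 0 < κ) (hP : 0 < P)
    (σ : ℝ × ℝ → ℝ) (η : ℝ → ℤ → ℤ → S → ℝ) (hη : NoiseAssumption μ κ pbar P σ η)
    (M : ℕ) (φ : ℝ → ℝ) (hφ : KernelAssumption M φ) (hM : ν + 1 < (M : ℝ))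
    (x₀ : Plane) (hx₀ : CenterAssumption κ P σ ν x₀)
    (K : ℕ) (xc : Fin K → Plane) (hxc : Function.Injective xc)
    (θ : Fin K → ℝ) (hθ : θ ≠ 0) :
    (∃ L > 0, Tendsto (fun ε : ℝ => Var[xi κ pbar P φ η x₀ xc θ ε; μ]) (𝓝[>] 0) (𝓝 L)) ∧
    (∀ᶠ ε : ℝ in 𝓝[>] 0, 0 < varianceSum μ κ pbar P φ η x₀ xc θ ε) ∧
    (fun ε : ℝ => thirdMomentSum μ κ pbar P φ η x₀ xc θ ε /
        varianceSum μ κ pbar P φ η x₀ xc θ ε ^ (3 / 2 : ℝ))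
      =O[𝓝[>] 0] (fun ε : ℝ => ε ^ (1 / 2 : ℝ)) := by
  have hpi := Real.pi_pos
  obtain ⟨R, hR⟩ := hφ.exists_support_bound
  obtain ⟨Lφ, hLφ⟩ := hφ.exists_lipschitz
  obtain ⟨C, _, hC⟩ := exists_hilbert_bound hLφ hR hφ.integral_deriv
  obtain ⟨C₁, hC₁, hC₁'⟩ := exists_lineWeight_bound (xc := xc) (θ := θ) hC
  obtain ⟨V, hV, hlim⟩ := tendsto_varianceSum hκ hP hη hφ hx₀ hxc hθ hC₁'
  obtain ⟨A, hA, hA'⟩ := exists_thirdMomentSum_le hκ hη φ x₀ xc θ hC₁.le hC₁'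
  refine ⟨⟨(κ / (4 * Real.pi)) ^ 2 * V, by positivity, (hlim.const_mul _).congr' ?_⟩,
    hlim.eventually_const_lt hV, ?_⟩
  · filter_upwards [self_mem_nhdsWithin] with ε hε
    exact (variance_xi_eq hη φ x₀ xc θ hε).symm
  · refine IsBigO.of_bound (A / (V / 2) ^ (3 / 2 : ℝ)) ?_
    have hκε : Tendsto (fun ε : ℝ => κ * ε) (𝓝[>] 0) (𝓝 0) := by
      have hid : Tendsto (fun ε : ℝ => ε) (𝓝[>] 0) (𝓝 0) := tendsto_id.mono_left nhdsWithin_le_nhds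
      simpa using hid.const_mul κ
    filter_upwards [self_mem_nhdsWithin, hlim.eventually_const_lt (half_lt_self hV),
      hκε.eventually_le_const one_pos] with ε (hε : 0 < ε) h1 h2
    have h3 : 0 ≤ thirdMomentSum μ κ pbar P φ η x₀ xc θ ε :=
      Finset.sum_nonneg fun q _ => mul_nonneg (by positivity)
        (integral_nonneg fun ω => by positivity)
    have h4 : 0 < varianceSum μ κ pbar P φ η x₀ xc θ ε := (half_pos hV).trans h1
    rw [Real.norm_of_nonneg (by positivity), Real.norm_of_nonneg (by positivity),
      div_mul_eq_mul_div]
    refine div_le_div₀ (by positivity) (hA' ε hε h2) (by positivity) ?_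
    exact Real.rpow_le_rpow (by positivity) h1.le (by norm_num)
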